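/- Let $\mathbb F$ be a subfield of $\mathbb R$ closed under $x\mapsto\sqrt{1+x^2}$, and let $\mathbb A=\mathbb F^2$ with the usual dot product. A functional $\xi:\mathbb A\to\mathbb F$ that is affine and nonconstant is called regular. A *polygon* in $\mathbb A$ is a union of finitely many bounded sets, each of which is an intersection of finitely many closed half-planes $\{x\in\mathbb A:\xi(x)\ge 0\}$ ($\xi$ regular) and is not contained in a line (the empty union is allowed). Its *area* is the Lebesgue measure of its closure in $\mathbb R^2$. Two subsets of $\mathbb A$ are *congruent* if some distance-preserving bijection of $\mathbb A$ maps one onto the other. Let $\widetilde{\mathbb A}$ be the set of all $(x;\rho_1,\rho_2)$ with $x\in\mathbb A$ and $(\rho_1,\rho_2)$ an orthonormal pair of vectors in $\mathbb F^2$, and let $\kappa(x;\rho_1,\rho_2)=x$. For regular $\xi$, the *refined half-plane* of $\xi$ is the set of $(x;\rho_1,\rho_2)\in\widetilde{\mathbb A}$ for which the first nonzero entry of $(\xi(x),\ \xi(x+\rho_1),\ \xi(x+\rho_1+\rho_2))$ exists and is positive. A *refined (possibly unbounded) $2$-polytope* is a finite union of finite intersections of refined half-planes. For a polygon $P$ in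 $\mathbb A$, its *refinement* $\widetilde P$ is the unique refined $2$-polytope with $\kappa(\widetilde P)=P$. **Theorem (Wallace–Bolyai–Gerwien).** Two polygons $P$ and $Q$ in $\mathbb A$ have the same area if and only if $\widetilde P$ and $\widetilde Q$ are equidecomposable, i.e. there exist an integer $m\ge 0$ and nonempty polygons $P_1,\dots,P_m,Q_1,\dots,Q_m$ in $\mathbb A$ such that $$\widetilde P=\bigsqcup_{i=1}^m\widetilde P_i,\qquad \widetilde Q=\bigsqcup_{i=1}^m\widetilde Q_i$$ are partitions (disjoint unions of sets) and $P_i$ is congruent to $Q_i$ for every $i$. -/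

import Mathlib

noncomputable section

namespace RefinedGeometry

/-- The coordinate space `F ^ d` over a subfield `F` of the reals
(used both as an affine space and as a vector space). -/
abbrev Space (F : Subfield ℝ) (d : ℕ) : Type := Fin d → F

/-! ### Conventional polytopes -/

/-- An affine functional is regular if it has full rank, i.e. if it is not constant. -/
def Regular {F : Subfield ℝ} {d : ℕ} (ξ : Space F d →ᵃ[F] F) : Prop :=
  ξ.linear ≠ 0

/-- The closed half-space `{ξ ≥ 0}`. -/
def closedHalfSpace {F : Subfield ℝ} {d : ℕ} (ξ : Space F d →ᵃ[F] F) : Set (Space F d) :=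
  {x | 0 ≤ ξ x}

/-- A convex polytope: a bounded intersection of finitely many closed half-spaces. -/
def IsConvexPolytope {F : Subfield ℝ} {d : ℕ} (C : Set (Space F d)) : Prop :=
  Bornology.IsBounded C ∧
    ∃ Ξ : Finset (Space F d →ᵃ[F] F),
      (∀ ξ ∈ Ξ, Regular ξ) ∧ C = ⋂ ξ ∈ Ξ, closedHalfSpace ξ

/-- The rank of a nonempty set: the dimension of the smallest affine subspace containing it. -/
def rank {F : Subfield ℝ} {d : ℕ} (C : Set (Space F d)) : ℕ :=
  Module.finrank F (affineSpan F C).direction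

/-- A `k`-polytope: the union of finitely many (nonempty) convex polytopes of rank `k`. -/
def IsPolytope {F : Subfield ℝ} {d : ℕ} (k : ℕ) (P : Set (Space F d)) : Prop :=
  ∃ 𝒞 : Set (Set (Space F d)), 𝒞.Finite ∧
    (∀ C ∈ 𝒞, IsConvexPolytope C ∧ C.Nonempty ∧ rank C = k) ∧ P = ⋃₀ 𝒞

/-- A polygon is a `2`-polytope. -/
def IsPolygon {F : Subfield ℝ} {d : ℕ} (P : Set (Space F d)) : Prop :=
  IsPolytope 2 P

/-! ### Refined polytopes of full dimension -/

/-- The resolution of a point of `F ^ d`: the orthonormal `d`-tuples of vectors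
with respect to the dot product. -/
def Resolution (F : Subfield ℝ) (d : ℕ) : Type :=
  {ρ : Fin d → Space F d // ∀ i j, ρ i ⬝ᵥ ρ j = if i = j then 1 else 0}

/-- The refined `d`-space of `F ^ d`: pairs `(x; ρ)` of a point and an orthonormal `d`-tuple. -/
abbrev RefinedSpace (F : Subfield ℝ) (d : ℕ) : Type := Space F d × Resolution F d

/-- The closing map `(x; ρ) ↦ x`. -/
def closing {F : Subfield ℝ} {d : ℕ} (z : RefinedSpace F d) : Space F d := z.1

/-- The refinement of an affine functional `ξ`:
`(x; v₁, …, v_d) ↦ (ξ x, ξ (x + v₁), …, ξ (x + v₁ + ⋯ + v_d))`. -/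
def refineFunctional {F : Subfield ℝ} {d : ℕ} (ξ : Space F d →ᵃ[F] F)
    (x : Space F d) (v : Fin d → Space F d) : Fin (d + 1) → F :=
  fun i => ξ (x + ∑ j : Fin d with j.castSucc < i, v j)

/-- Lexicographic positivity `a ≻ 0`: the first nonzero entry exists and is positive. -/
def LexPos {F : Subfield ℝ} {n : ℕ} (a : Fin n → F) : Prop :=
  ∃ i₀, 0 < a i₀ ∧ ∀ i < i₀, a i = 0

/-- The refined half-space of points `(x; ρ)` at which the refinement of `ξ` is `≻ 0`. -/
def refinedHalfSpace {F : Subfield ℝ} {d : ℕ} (ξ : Space F d →ᵃ[F] F) :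
    Set (RefinedSpace F d) :=
  {z | LexPos (refineFunctional ξ z.1 z.2.1)}

/-- A (possibly unbounded) refined convex `d`-polytope in `F ^ d`. -/
def IsRefinedConvexPolytope {F : Subfield ℝ} {d : ℕ} (S : Set (RefinedSpace F d)) : Prop :=
  ∃ Ξ : Finset (Space F d →ᵃ[F] F),
    (∀ ξ ∈ Ξ, Regular ξ) ∧ S = ⋂ ξ ∈ Ξ, refinedHalfSpace ξ

/-- A (possibly unbounded) refined `d`-polytope in `F ^ d`. -/
def IsRefinedPolytope {F : Subfield ℝ} {d : ℕ} (S : Set (RefinedSpace F d)) : Prop :=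
  ∃ 𝒮 : Set (Set (RefinedSpace F d)), 𝒮.Finite ∧
    (∀ C ∈ 𝒮, IsRefinedConvexPolytope C) ∧ S = ⋃₀ 𝒮

/-- The refined `d`-polytope corresponding to a `d`-polytope `P` of `F ^ d`: the inverse image
of `P` under the map `S ↦ closing '' S` from refined `d`-polytopes to subsets of `F ^ d`. -/
def refinement {F : Subfield ℝ} {d : ℕ} (P : Set (Space F d)) : Set (RefinedSpace F d) :=
  Function.invFunOn (fun S : Set (RefinedSpace F d) => closing '' S) {S | IsRefinedPolytope S} P

/-! ### Area, congruence, equidecomposability -/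

/-- The area of a polygon of `F ^ 2`: the Lebesgue measure of the polygon that it spans in `ℝ ^ 2`,
which is the topological closure of its image (`F` may be countable, but it is dense in `ℝ`). -/
def area {F : Subfield ℝ} (P : Set (Space F 2)) : ENNReal :=
  MeasureTheory.volume (closure ((fun (x : Space F 2) (i : Fin 2) => (x i : ℝ)) '' P))

/-- Two figures are congruent if a bijection of `F ^ d` that preserves the Euclidean distance
carries one to the other. -/
def Congruent {F : Subfield ℝ} {d : ℕ} (P Q : Set (Space F d)) : Prop :=
  ∃ g : Space F d ≃ Space F d,
    (∀ x y, (g x - g y) ⬝ᵥ (g x - g y) = (x - y) ⬝ᵥ (x - y)) ∧ g '' P = Q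

/-- The refined polygons `refinement (P i)`, `i < m`, corresponding to the nonempty polygons `P i`, form a
partition of `S`. -/
def IsRefinedPartition {F : Subfield ℝ} {m : ℕ} (P : Fin m → Set (Space F 2))
    (S : Set (RefinedSpace F 2)) : Prop :=
  (∀ i, IsPolygon (P i) ∧ (P i).Nonempty) ∧
    (∀ i j, i ≠ j → Disjoint (refinement (P i)) (refinement (P j))) ∧
    S = ⋃ i, refinement (P i)

/-- Two sets in the refined plane are equidecomposable if they can be partitioned into the same
number of refined polygons such that corresponding polygons are congruent. -/
def Equidecomposable {F : Subfield ℝ} (S T : Set (RefinedSpace F 2)) : Prop :=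
  ∃ (m : ℕ) (P Q : Fin m → Set (Space F 2)),
    IsRefinedPartition P S ∧ IsRefinedPartition Q T ∧ ∀ i, Congruent (P i) (Q i)

end RefinedGeometry

end

/-!
Call a statement about points of `F ^ d` generic if it holds outside finitely many hyperplanes. The
germ of a refined point `(x; ρ)` is the filter of sets containing all `x + ε₁ ρ₁ + ⋯ + ε_d ρ_d` with
`0 < ε_d ≪ ⋯ ≪ ε₁ ≪ 1`. It is finer than the generic filter and decides every polyhedral set, so
`S ↦ {z | S ∈ germ z}` identifies polyhedral sets modulo generic equality with refined polytopes.
Since `F` is closed under `x ↦ √(1 + x ^ 2)`, at every point of a convex polytope some orthonormal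
frame points towards the interior, so a polytope is the closing of its set of germs, which is
therefore its refinement. Partitions of refinements are thus partitions of polygons up to finitely
many lines, and area is additive over these.

For the converse, translations and point reflections suffice. They form a normal subgroup of the
affine group, so the linear maps of determinant one that carry the unit square to a scissors
congruent set form a group; it contains the shears with coefficient in `[0, 1]`, whose powers and
products give all of `SL₂`. As a triangle is scissors congruent to a parallelogram, it is scissors
congruent to a rectangle with base `1`. Stacking the rectangles obtained from a triangulation gives
a rectangle determined by the area.
-/

noncomputable section

namespace RefinedGeometry

open Filter Set MeasureTheory

variable {F : Subfield ℝ} {d : ℕ}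

/-! ### Affine functionals -/

theorem apply_add (ξ : Space F d →ᵃ[F] F) (x v : Space F d) :
    ξ (x + v) = ξ x + ξ.linear v := by
  simpa only [vadd_eq_add, add_comm] using ξ.map_vadd x v

theorem regular_of_apply_ne {ξ : Space F d →ᵃ[F] F} {x y : Space F d} (h : ξ x ≠ ξ y) :
    Regular ξ := fun h₀ => h <| by
  rw [← sub_eq_zero, ← vsub_eq_sub, ← ξ.linearMap_vsub, h₀, LinearMap.zero_apply]

theorem Regular.exists_linear_ne_zero {ξ : Space F d →ᵃ[F] F} (h : Regular ξ) :
    ∃ v, ξ.linear v ≠ 0 := by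
  by_contra! h₀
  exact h (LinearMap.ext h₀)

theorem Regular.comp {ξ : Space F d →ᵃ[F] F} (h : Regular ξ) (φ : Space F d ≃ᵃ[F] Space F d) :
    Regular (ξ.comp φ.toAffineMap) := by
  obtain ⟨v, hv⟩ := h.exists_linear_ne_zero
  exact fun h₀ => hv <| by simpa using congr($h₀ (φ.linear.symm v))

/-- The affine functional `x ↦ a · x + c`. -/
def affineFunctional (a : Space F d) (c : F) : Space F d →ᵃ[F] F :=
  (dotProductBilin F F a).toAffineMap + AffineMap.const F (Space F d) c

@[simp]
theorem affineFunctional_apply (a : Space F d) (c : F) (x : Space F d) :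
    affineFunctional a c x = a ⬝ᵥ x + c := rfl

@[simp]
theorem affineFunctional_linear_apply (a : Space F d) (c : F) (v : Space F d) :
    (affineFunctional a c).linear v = a ⬝ᵥ v := by
  simp [affineFunctional, dotProductBilin]

theorem regular_affineFunctional {a : Space F d} (ha : a ≠ 0) (c : F) :
    Regular (affineFunctional a c) := fun h =>
  ha <| dotProduct_eq_zero a fun v => by simpa using congr($h v)

theorem exists_eq_affineFunctional (ξ : Space F d →ᵃ[F] F) :
    ∃ a c, ξ = affineFunctional a c := by
  refine ⟨fun i => ξ.linear fun j => if i = j then 1 else 0, ξ 0, AffineMap.ext fun x => ?_⟩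
  have h := apply_add ξ 0 x
  rw [zero_add, LinearMap.pi_apply_eq_sum_univ] at h
  rw [h, affineFunctional_apply, add_comm, dotProduct]
  congr 1
  exact Finset.sum_congr rfl fun i _ => mul_comm _ _

/-! ### Generic points -/

/-- The filter of properties that hold outside a finite union of hyperplanes. -/
def generic (F : Subfield ℝ) (d : ℕ) : Filter (Space F d) :=
  ⨅ (ξ : Space F d →ᵃ[F] F) (_ : Regular ξ), 𝓟 {x | ξ x ≠ 0}

theorem Regular.eventually_ne {ξ : Space F d →ᵃ[F] F} (h : Regular ξ) :
    ∀ᶠ x in generic F d, ξ x ≠ 0 :=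
  mem_iInf_of_mem ξ (mem_iInf_of_mem h (mem_principal_self _))

theorem tendsto_generic (φ : Space F d ≃ᵃ[F] Space F d) :
    Tendsto φ (generic F d) (generic F d) :=
  tendsto_iInf.2 fun _ => tendsto_iInf.2 fun h => tendsto_principal.2 (h.comp φ).eventually_ne

/-! ### Polyhedral sets -/

/-- A set is polyhedral if membership of a point depends only on its position with respect to
finitely many hyperplanes. Such sets may be unbounded and need not be closed, and they form a
Boolean algebra. -/
def Polyhedral (S : Set (Space F d)) : Prop :=
  ∃ Ξ : Set (Space F d →ᵃ[F] F), Ξ.Finite ∧ (∀ ξ ∈ Ξ, Regular ξ) ∧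
    ∀ x y, (∀ ξ ∈ Ξ, SignType.sign (ξ x) = SignType.sign (ξ y)) → (x ∈ S ↔ y ∈ S)

namespace Polyhedral

theorem compl {S : Set (Space F d)} (h : Polyhedral S) : Polyhedral Sᶜ := by
  obtain ⟨Ξ, hf, hr, h⟩ := h
  exact ⟨Ξ, hf, hr, fun x y hxy => not_congr (h x y hxy)⟩

theorem inter {S T : Set (Space F d)} (hS : Polyhedral S) (hT : Polyhedral T) :
    Polyhedral (S ∩ T) := by
  obtain ⟨Ξ, hf, hr, h⟩ := hS
  obtain ⟨Ξ', hf', hr', h'⟩ := hT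
  exact ⟨Ξ ∪ Ξ', hf.union hf', fun ξ hξ => hξ.elim (hr ξ) (hr' ξ), fun x y hxy => and_congr
    (h x y fun ξ hξ => hxy ξ (.inl hξ)) (h' x y fun ξ hξ => hxy ξ (.inr hξ))⟩

theorem empty : Polyhedral (∅ : Set (Space F d)) :=
  ⟨∅, finite_empty, by simp, by simp⟩

theorem iUnion {ι : Type*} [Finite ι] {S : ι → Set (Space F d)} (h : ∀ i, Polyhedral (S i)) :
    Polyhedral (⋃ i, S i) := by
  choose Ξ hf hr h using h
  refine ⟨⋃ i, Ξ i, finite_iUnion hf, fun ξ hξ => ?_, fun x y hxy => ?_⟩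
  · obtain ⟨i, hi⟩ := mem_iUnion.1 hξ
    exact hr i ξ hi
  · simp only [mem_iUnion]
    exact exists_congr fun i => h i x y fun ξ hξ => hxy ξ (mem_iUnion_of_mem i hξ)

theorem iInter {ι : Type*} [Finite ι] {S : ι → Set (Space F d)} (h : ∀ i, Polyhedral (S i)) :
    Polyhedral (⋂ i, S i) := by
  rw [← compl_compl (⋂ i, S i), compl_iInter]
  exact (iUnion fun i => (h i).compl).compl

theorem preimage {S : Set (Space F d)} (hS : Polyhedral S) (φ : Space F d ≃ᵃ[F] Space F d) :
    Polyhedral (φ ⁻¹' S) := by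
  obtain ⟨Ξ, hf, hr, h⟩ := hS
  refine ⟨(fun ξ : Space F d →ᵃ[F] F => ξ.comp φ.toAffineMap) '' Ξ, hf.image _,
    forall_mem_image.2 fun ξ hξ => (hr ξ hξ).comp φ, fun x y hxy => ?_⟩
  exact h _ _ fun ξ hξ => hxy _ (mem_image_of_mem _ hξ)

theorem image {S : Set (Space F d)} (hS : Polyhedral S) (φ : Space F d ≃ᵃ[F] Space F d) :
    Polyhedral (φ '' S) := by
  have : φ '' S = φ.symm ⁻¹' S := φ.toEquiv.image_eq_preimage_symm S
  exact this ▸ hS.preimage φ.symm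

end Polyhedral

theorem polyhedral_closedHalfSpace {ξ : Space F d →ᵃ[F] F} (h : Regular ξ) :
    Polyhedral (closedHalfSpace ξ) := by
  refine ⟨{ξ}, finite_singleton _, by simpa using h, fun x y hxy => ?_⟩
  rw [closedHalfSpace, mem_ofPred_eq, mem_ofPred_eq, ← sign_nonneg_iff, hxy ξ rfl,
    sign_nonneg_iff]

theorem polyhedral_biInter_closedHalfSpace {Ξ : Finset (Space F d →ᵃ[F] F)}
    (h : ∀ ξ ∈ Ξ, Regular ξ) : Polyhedral (⋂ ξ ∈ Ξ, closedHalfSpace ξ) := by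
  rw [← Finset.set_biInter_coe, biInter_eq_iInter]
  exact .iInter fun ξ => polyhedral_closedHalfSpace (h ξ ξ.2)

theorem IsConvexPolytope.polyhedral {C : Set (Space F d)} (h : IsConvexPolytope C) :
    Polyhedral C := by
  obtain ⟨-, Ξ, hΞ, rfl⟩ := h
  exact polyhedral_biInter_closedHalfSpace hΞ

theorem IsPolytope.polyhedral {k : ℕ} {P : Set (Space F d)} (h : IsPolytope k P) :
    Polyhedral P := by
  obtain ⟨𝒞, hf, hC, rfl⟩ := h
  have := hf.to_subtype
  rw [sUnion_eq_iUnion]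
  exact .iUnion fun C => (hC C C.2).1.polyhedral

theorem IsPolytope.isBounded {k : ℕ} {P : Set (Space F d)} (h : IsPolytope k P) :
    Bornology.IsBounded P := by
  obtain ⟨𝒞, hf, hC, rfl⟩ := h
  exact (Bornology.isBounded_sUnion hf).2 fun C h => (hC C h).1.1

/-! ### Germs at points of the refined space -/

theorem lexPos_cons {n : ℕ} {a : F} {b : Fin n → F} :
    LexPos (Fin.cons a b : Fin (n + 1) → F) ↔ 0 < a ∨ a = 0 ∧ LexPos b := by
  simp only [LexPos, Fin.exists_fin_succ, Fin.forall_fin_succ, Fin.cons_zero, Fin.cons_succ,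
    Fin.succ_lt_succ_iff, Fin.succ_pos, Fin.not_lt_zero, forall_const, false_imp_iff]
  grind

theorem lexPos_or_lexPos_neg {n : ℕ} {a : Fin n → F} (ha : a ≠ 0) :
    LexPos a ∨ LexPos (-a) := by
  obtain ⟨i, hi, hmin⟩ := wellFounded_lt.has_min {i | a i ≠ 0} (Function.ne_iff.1 ha)
  have hlt : ∀ j < i, a j = 0 := fun j hj => by_contra fun h => hmin j h hj
  rcases lt_or_gt_of_ne hi with h | h
  · exact .inr ⟨i, neg_pos.2 h, fun j hj => neg_eq_zero.2 (hlt j hj)⟩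
  · exact .inl ⟨i, h, hlt⟩

theorem LexPos.of_eq {n : ℕ} {a b : Fin n → F} (h : ∀ i, (∀ j < i, a j = 0) → a i = b i)
    (ha : LexPos a) : LexPos b := by
  obtain ⟨i, hi, hlt⟩ := ha
  exact ⟨i, h i hlt ▸ hi, fun j hj => h j (fun k hk => hlt k (hk.trans hj)) ▸ hlt j hj⟩

theorem refineFunctional_eq (ξ : Space F d →ᵃ[F] F) (x : Space F d) (v : Fin d → Space F d)
    (i : Fin (d + 1)) :
    refineFunctional ξ x v i = ξ x + ∑ j : Fin d with j.castSucc < i, ξ.linear (v j) := by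
  rw [refineFunctional, apply_add, map_sum]

theorem refineFunctional_succ (ξ : Space F d →ᵃ[F] F) (x : Space F d) (v : Fin d → Space F d)
    (i : Fin d) :
    refineFunctional ξ x v i.succ = refineFunctional ξ x v i.castSucc + ξ.linear (v i) := by
  have : ({j : Fin d | j.castSucc < i.succ} : Finset (Fin d)) =
      insert i ({j : Fin d | j.castSucc < i.castSucc} : Finset (Fin d)) := by
    ext j
    simp [Fin.castSucc_lt_succ_iff, le_iff_eq_or_lt]
  rw [refineFunctional_eq, refineFunctional_eq, this, Finset.sum_insert (by simp)]
  ring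

theorem lexPos_refineFunctional_iff {ξ : Space F d →ᵃ[F] F} {x : Space F d}
    {v : Fin d → Space F d} :
    LexPos (refineFunctional ξ x v) ↔
      LexPos (Fin.cons (ξ x) fun i => ξ.linear (v i) : Fin (d + 1) → F) := by
  constructor <;> refine LexPos.of_eq fun i => Fin.cases (fun _ => ?_) (fun i h => ?_) i
  · simp [refineFunctional_eq]
  · rw [refineFunctional_succ, h _ i.castSucc_lt_succ, zero_add, Fin.cons_succ]
  · simp [refineFunctional_eq]
  · rw [refineFunctional_eq, Fin.cons_succ, show ξ x = 0 from h 0 i.succ_pos, zero_add,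
      Finset.sum_eq_single i]
    · intro j hj hji
      exact h j.succ (Fin.succ_lt_succ_iff.2
        ((Fin.castSucc_lt_succ_iff.1 (Finset.mem_filter.1 hj).2).lt_of_ne hji))
    · simp

theorem Resolution.toMatrix_mul_transpose (ρ : Resolution F d) :
    Matrix.of ρ.1 * (Matrix.of ρ.1).transpose = 1 := by
  refine Matrix.ext fun i j => ?_
  rw [Matrix.mul_apply, Matrix.one_apply]
  exact ρ.2 i j

theorem Resolution.sum_dotProduct_smul (ρ : Resolution F d) (x : Space F d) :
    ∑ i, (ρ.1 i ⬝ᵥ x) • ρ.1 i = x := by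
  have h := mul_eq_one_comm.1 ρ.toMatrix_mul_transpose
  calc ∑ i, (ρ.1 i ⬝ᵥ x) • ρ.1 i
      = (Matrix.of ρ.1).transpose.mulVec ((Matrix.of ρ.1).mulVec x) := by
        ext j
        simp [Matrix.mulVec, dotProduct, mul_comm]
    _ = x := by rw [Matrix.mulVec_mulVec, h, Matrix.one_mulVec]

theorem Resolution.exists_linear_ne_zero {ξ : Space F d →ᵃ[F] F} (hξ : Regular ξ)
    (ρ : Resolution F d) : ∃ i, ξ.linear (ρ.1 i) ≠ 0 := by
  by_contra! h
  refine hξ (LinearMap.ext fun x => ?_)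
  rw [← ρ.sum_dotProduct_smul x, map_sum]
  exact Finset.sum_eq_zero fun i _ => by rw [map_smul, h, smul_zero]

theorem mem_refinedHalfSpace_or_neg {ξ : Space F d →ᵃ[F] F} (hξ : Regular ξ)
    (z : RefinedSpace F d) : z ∈ refinedHalfSpace ξ ∨ z ∈ refinedHalfSpace (-ξ) := by
  obtain ⟨i, hi⟩ := z.2.exists_linear_ne_zero hξ
  have ha : (Fin.cons (ξ z.1) fun i => ξ.linear (z.2.1 i) : Fin (d + 1) → F) ≠ 0 :=
    Function.ne_iff.2 ⟨i.succ, hi⟩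
  refine (lexPos_or_lexPos_neg ha).imp lexPos_refineFunctional_iff.2 fun h =>
    lexPos_refineFunctional_iff.2 ?_
  convert h using 1
  ext j
  cases j using Fin.cases <;> simp

/-- The filter of sets that contain `x + ε₀ v₀ + ⋯ + εₙ₋₁ vₙ₋₁` whenever `ε₀ > 0` is small, `ε₁ > 0`
is small in comparison with `ε₀`, and so on. -/
def germAlong : (n : ℕ) → Space F d → (Fin n → Space F d) → Filter (Space F d)
  | 0, x, _ => pure x
  | n + 1, x, v => (atTop : Filter F).bind fun s => germAlong n (x + s⁻¹ • v 0) (Fin.tail v)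

instance germAlong_neBot (n : ℕ) (x : Space F d) (v : Fin n → Space F d) :
    (germAlong n x v).NeBot := by
  induction n generalizing x with
  | zero => exact pure_neBot
  | succ n ih =>
    refine ⟨fun h => ?_⟩
    obtain ⟨s, hs⟩ := Eventually.exists (mem_bind'.1 (empty_mem_iff_bot.2 h))
    have := ih (x + s⁻¹ • v 0) (Fin.tail v)
    exact empty_notMem _ hs

theorem eventually_add_inv_mul_pos {a : F} (ha : 0 < a) (b : F) :
    ∀ᶠ s : F in atTop, 0 < a + s⁻¹ * b := by
  filter_upwards [eventually_gt_atTop 0, eventually_gt_atTop (-b / a)] with s hs hs'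
  rw [div_lt_iff₀ ha] at hs'
  rw [show a + s⁻¹ * b = s⁻¹ * (s * a + b) by field_simp]
  exact mul_pos (inv_pos.2 hs) (by linarith)

theorem eventually_germAlong_pos (ξ : Space F d →ᵃ[F] F) {n : ℕ} {x : Space F d}
    {v : Fin n → Space F d}
    (h : LexPos (Fin.cons (ξ x) fun i => ξ.linear (v i) : Fin (n + 1) → F)) :
    ∀ᶠ y in germAlong n x v, 0 < ξ y := by
  induction n generalizing x with
  | zero =>
    rw [lexPos_cons] at h
    exact h.resolve_right fun ⟨_, i, _⟩ => i.elim0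
  | succ n ih =>
    suffices ∀ᶠ s : F in atTop, LexPos (Fin.cons (ξ (x + s⁻¹ • v 0)) fun i =>
        ξ.linear (Fin.tail v i) : Fin (n + 1) → F) from this.mono fun s hs => ih hs
    have hv : (fun i => ξ.linear (v i)) =
        Fin.cons (ξ.linear (v 0)) fun i => ξ.linear (Fin.tail v i) := by
      ext i
      cases i using Fin.cases <;> rfl
    rw [lexPos_cons, hv, lexPos_cons] at h
    simp only [lexPos_cons, apply_add, map_smul, smul_eq_mul]
    rcases h with h | ⟨h, h' | ⟨h', h''⟩⟩
    · exact (eventually_add_inv_mul_pos h _).mono fun s hs => .inl hs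
    · filter_upwards [eventually_gt_atTop 0] with s hs
      exact .inl (by rw [h, zero_add]; exact mul_pos (inv_pos.2 hs) h')
    · exact .of_forall fun s => .inr ⟨by rw [h, h', mul_zero, add_zero], h''⟩

/-- The filter of sets that contain the germ of a flag-shaped neighbourhood at `z = (x; ρ)`: all
points obtained from `x` by a small step along `ρ₀`, a far smaller one along `ρ₁`, and so on. -/
def germ (z : RefinedSpace F d) : Filter (Space F d) := germAlong d z.1 z.2.1

instance germ_neBot (z : RefinedSpace F d) : (germ z).NeBot := germAlong_neBot d z.1 z.2.1

theorem eventually_germ_pos {ξ : Space F d →ᵃ[F] F} {z : RefinedSpace F d}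
    (h : z ∈ refinedHalfSpace ξ) : ∀ᶠ x in germ z, 0 < ξ x :=
  eventually_germAlong_pos ξ (lexPos_refineFunctional_iff.1 h)

theorem nonneg_of_mem_refinedHalfSpace {ξ : Space F d →ᵃ[F] F} {z : RefinedSpace F d}
    (h : z ∈ refinedHalfSpace ξ) : 0 ≤ ξ z.1 :=
  (lexPos_cons.1 (lexPos_refineFunctional_iff.1 h)).elim le_of_lt fun h => h.1.ge

theorem exists_sign_germ {ξ : Space F d →ᵃ[F] F} (hξ : Regular ξ) (z : RefinedSpace F d) :
    ∃ σ : SignType, σ ≠ 0 ∧ (∀ᶠ x in germ z, SignType.sign (ξ x) = σ) ∧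
      (ξ z.1 ≠ 0 → SignType.sign (ξ z.1) = σ) := by
  rcases mem_refinedHalfSpace_or_neg hξ z with h | h
  · exact ⟨1, by decide, (eventually_germ_pos h).mono fun x hx => sign_pos hx, fun h₀ =>
      sign_pos ((nonneg_of_mem_refinedHalfSpace h).lt_of_ne' h₀)⟩
  · exact ⟨-1, by decide, (eventually_germ_pos h).mono fun x hx => sign_neg (neg_pos.1 hx),
      fun h₀ => sign_neg ((neg_nonneg.1 (nonneg_of_mem_refinedHalfSpace h)).lt_of_ne h₀)⟩

theorem germ_le_generic (z : RefinedSpace F d) : germ z ≤ generic F d := by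
  refine le_iInf₂ fun ξ hξ => le_principal_iff.2 ?_
  obtain ⟨σ, hσ, h, -⟩ := exists_sign_germ hξ z
  filter_upwards [h] with x hx h₀
  exact hσ (by rw [← hx, sign_eq_zero_iff, h₀])

theorem Polyhedral.mem_germ_or_compl {S : Set (Space F d)} (hS : Polyhedral S)
    (z : RefinedSpace F d) : S ∈ germ z ∨ Sᶜ ∈ germ z := by
  obtain ⟨Ξ, hf, hr, h⟩ := hS
  choose! σ _ hσ _ using fun ξ hξ => exists_sign_germ (hr ξ hξ) z
  have key : ∀ᶠ x in germ z, ∀ ξ ∈ Ξ, SignType.sign (ξ x) = σ ξ :=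
    (eventually_all_finite hf).2 hσ
  obtain ⟨y, hy⟩ := key.exists
  have hmem : ∀ᶠ x in germ z, (x ∈ S ↔ y ∈ S) :=
    key.mono fun x hx => h x y fun ξ hξ => (hx ξ hξ).trans (hy ξ hξ).symm
  by_cases hyS : y ∈ S
  · exact .inl (hmem.mono fun x hx => hx.2 hyS)
  · exact .inr (hmem.mono fun x hx hxS => hyS (hx.1 hxS))

theorem Polyhedral.eventually_mem_germ_iff {S : Set (Space F d)} (hS : Polyhedral S) :
    ∀ᶠ x in generic F d, ∀ ρ : Resolution F d, S ∈ germ (x, ρ) ↔ x ∈ S := by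
  obtain ⟨Ξ, hf, hr, h⟩ := hS
  filter_upwards [(eventually_all_finite hf).2 fun ξ hξ => (hr ξ hξ).eventually_ne] with x hx ρ
  have hmem : ∀ᶠ y in germ (x, ρ), (y ∈ S ↔ x ∈ S) := by
    refine ((eventually_all_finite hf).2 fun ξ hξ => ?_).mono fun y => h y x
    obtain ⟨σ, -, hσ, hσ'⟩ := exists_sign_germ (hr ξ hξ) (x, ρ)
    rwa [hσ' (hx ξ hξ)]
  exact (eventually_congr hmem).trans eventually_const

/-! ### The refinement of a polytope -/

/-- The points of the refined space whose germ lies in `S`. -/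
def germSet (S : Set (Space F d)) : Set (RefinedSpace F d) :=
  {z | S ∈ germ z}

theorem germSet_congr {S T : Set (Space F d)} (h : S =ᶠ[generic F d] T) :
    germSet S = germSet T := by
  ext z
  exact congr_sets (f := germ z) (h.filter_mono (germ_le_generic z)).mem_iff

theorem germSet_closedHalfSpace {ξ : Space F d →ᵃ[F] F} (hξ : Regular ξ) :
    germSet (closedHalfSpace ξ) = refinedHalfSpace ξ := by
  refine Subset.antisymm (fun z h => ?_) fun z h => (eventually_germ_pos h).mono fun x => le_of_lt
  refine (mem_refinedHalfSpace_or_neg hξ z).resolve_right fun h' => ?_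
  obtain ⟨x, hx, hx'⟩ := ((eventually_germ_pos h').and h).exists
  exact (neg_pos.1 hx).not_ge hx'

theorem germSet_biInter_closedHalfSpace {Ξ : Finset (Space F d →ᵃ[F] F)}
    (h : ∀ ξ ∈ Ξ, Regular ξ) :
    germSet (⋂ ξ ∈ Ξ, closedHalfSpace ξ) = ⋂ ξ ∈ Ξ, refinedHalfSpace ξ := by
  ext z
  rw [mem_iInter₂]
  exact (biInter_finset_mem (f := germ z) Ξ).trans
    (forall₂_congr fun ξ hξ => by rw [← germSet_closedHalfSpace (h ξ hξ)]; rfl)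

theorem germSet_iUnion {ι : Type*} [Finite ι] {S : ι → Set (Space F d)}
    (h : ∀ i, Polyhedral (S i)) : germSet (⋃ i, S i) = ⋃ i, germSet (S i) := by
  refine Subset.antisymm (fun z hz => ?_) (iUnion_subset fun i z hz =>
    mem_of_superset (f := germ z) hz (subset_iUnion S i))
  by_contra hS
  simp only [mem_iUnion, not_exists] at hS
  have hc : ∀ᶠ x in germ z, ∀ i, x ∈ (S i)ᶜ :=
    eventually_all.2 fun i => ((h i).mem_germ_or_compl z).resolve_left (hS i)
  obtain ⟨x, hx, hxS⟩ := (hc.and hz).exists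
  obtain ⟨i, hi⟩ := mem_iUnion.1 hxS
  exact hx i hi

theorem IsRefinedPolytope.exists_eq_germSet {S : Set (RefinedSpace F d)}
    (h : IsRefinedPolytope S) : ∃ P : Set (Space F d), Polyhedral P ∧ S = germSet P := by
  obtain ⟨𝒮, hf, hC, rfl⟩ := h
  have := hf.to_subtype
  choose Ξ hΞ hS using fun C : 𝒮 => hC C C.2
  have hP : ∀ C, Polyhedral (⋂ ξ ∈ Ξ C, closedHalfSpace ξ) := fun C =>
    polyhedral_biInter_closedHalfSpace (hΞ C)
  refine ⟨⋃ C, ⋂ ξ ∈ Ξ C, closedHalfSpace ξ, .iUnion hP, ?_⟩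
  rw [germSet_iUnion hP, sUnion_eq_iUnion]
  exact iUnion_congr fun C => by rw [germSet_biInter_closedHalfSpace (hΞ C), ← hS]

theorem closing_image_germSet_eventuallyEq {P : Set (Space F d)} (hP : Polyhedral P)
    (ρ : Resolution F d) : closing '' germSet P =ᶠ[generic F d] P := by
  filter_upwards [hP.eventually_mem_germ_iff] with x hx
  refine propext ⟨?_, fun h => ⟨(x, ρ), (hx ρ).2 h, rfl⟩⟩
  rintro ⟨⟨_, ρ'⟩, h, rfl⟩
  exact (hx ρ').1 h

theorem exists_pos_of_rank_eq {C : Set (Space F d)} (hrank : rank C = d)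
    {ξ : Space F d →ᵃ[F] F} (hξ : Regular ξ) (hC : ∀ x ∈ C, 0 ≤ ξ x) : ∃ x ∈ C, 0 < ξ x := by
  by_contra! h
  have h₀ : ∀ x ∈ C, ξ x = 0 := fun x hx => le_antisymm (h x hx) (hC x hx)
  have htop : (affineSpan F C).direction = ⊤ :=
    Submodule.eq_top_of_finrank_eq (hrank.trans (Module.finrank_fin_fun F).symm)
  refine hξ (LinearMap.ker_eq_top.1 (eq_top_iff.2 ?_))
  rw [← htop, direction_affineSpan, vectorSpan, Submodule.span_le]
  rintro _ ⟨x, hx, y, hy, rfl⟩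
  change ξ.linear (x -ᵥ y) = 0
  rw [ξ.linearMap_vsub, h₀ x hx, h₀ y hy, vsub_self]

theorem exists_forall_pos_of_rank_eq {C : Set (Space F d)} (hne : C.Nonempty)
    (hconv : Convex F C) (hrank : rank C = d) {Ξ : Finset (Space F d →ᵃ[F] F)}
    (hΞ : ∀ ξ ∈ Ξ, Regular ξ) (hC : ∀ ξ ∈ Ξ, ∀ x ∈ C, 0 ≤ ξ x) :
    ∃ c ∈ C, ∀ ξ ∈ Ξ, 0 < ξ c := by
  classical
  induction Ξ using Finset.induction_on with
  | empty => exact ⟨hne.some, hne.some_mem, by simp⟩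
  | insert ξ Ξ _ ih =>
    simp only [Finset.forall_mem_insert] at hΞ hC ⊢
    obtain ⟨p, hpC, hp⟩ := ih hΞ.2 hC.2
    obtain ⟨q, hqC, hq⟩ := exists_pos_of_rank_eq hrank hΞ.1 hC.1
    have hmid : ∀ η : Space F d →ᵃ[F] F, η (midpoint F p q) = (η p + η q) / 2 := fun η => by
      rw [η.map_midpoint, midpoint_eq_smul_add, smul_eq_mul, invOf_eq_inv]
      ring
    refine ⟨midpoint F p q, hconv.midpoint_mem hpC hqC, ?_, fun η hη => ?_⟩ <;> rw [hmid]
    · linarith [hC.1 p hpC]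
    · linarith [hp η hη, hC.2 η hη q hqC]

theorem convex_biInter_closedHalfSpace (Ξ : Finset (Space F d →ᵃ[F] F)) :
    Convex F (⋂ ξ ∈ Ξ, closedHalfSpace ξ) :=
  convex_iInter₂ fun ξ _ => (convex_Ici (0 : F)).affine_preimage ξ

theorem exists_sq_eq_sum_sq (hF : ∀ x ∈ F, √(1 + x ^ 2) ∈ F) {n : ℕ} (v : Fin n → F) :
    ∃ r : F, r * r = v ⬝ᵥ v := by
  induction n with
  | zero => exact ⟨0, by simp⟩
  | succ n ih =>
    obtain ⟨r, hr⟩ := ih (Fin.tail v)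
    have hv : v ⬝ᵥ v = v 0 * v 0 + r * r := by
      rw [hr, dotProduct, Fin.sum_univ_succ]
      rfl
    rw [hv]
    by_cases h₀ : v 0 = 0
    · exact ⟨r, by rw [h₀, zero_mul, zero_add]⟩
    · obtain ⟨s, hs⟩ : ∃ s : F, s * s = 1 + (r / v 0) ^ 2 :=
        ⟨⟨_, hF _ (r / v 0).2⟩, Subtype.ext (Real.mul_self_sqrt (by positivity))⟩
      refine ⟨v 0 * s, ?_⟩
      rw [mul_mul_mul_comm, hs]
      field_simp

/-- The image of the standard frame under the reflection `x ↦ x - 2 (w · x) / (w · w) w`, which for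
`w = 0` is the identity by the convention `x / 0 = 0`. -/
def householder (w : Space F d) : Resolution F d :=
  ⟨fun i => Pi.single i 1 - (2 * w i / (w ⬝ᵥ w)) • w, fun i j => by
    simp only [sub_dotProduct, dotProduct_sub, smul_dotProduct, dotProduct_smul,
      single_one_dotProduct, dotProduct_single_one, Pi.sub_apply, Pi.smul_apply, smul_eq_mul,
      Pi.single_apply, eq_comm (a := j)]
    by_cases hw : w ⬝ᵥ w = 0
    · simp [hw]
    · field_simp
      ring⟩

instance : Nonempty (Resolution F d) := ⟨householder 0⟩

theorem exists_resolution_smul_eq (hF : ∀ x ∈ F, √(1 + x ^ 2) ∈ F) {n : ℕ}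
    {v : Space F (n + 1)} (hv : v ≠ 0) :
    ∃ (ρ : Resolution F (n + 1)) (r : F), 0 < r ∧ v = r • ρ.1 0 := by
  obtain ⟨r, hr⟩ : ∃ r : F, 0 < r ∧ r * r = v ⬝ᵥ v := by
    obtain ⟨r, hr⟩ := exists_sq_eq_sum_sq hF v
    refine ⟨|r|, abs_pos.2 ?_, by rw [abs_mul_abs_self, hr]⟩
    rintro rfl
    exact hv (dotProduct_self_eq_zero.1 (by rw [← hr, zero_mul]))
  -- The reflection in the direction of `v - r e₀` exchanges `v` and `r e₀`.
  obtain ⟨w, rfl⟩ : ∃ w, v = w + r • Pi.single 0 1 := ⟨_, (sub_add_cancel v _).symm⟩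
  refine ⟨householder w, r, hr.1, ?_⟩
  have hw : w ⬝ᵥ w = -(2 * r * w 0) := by
    have := hr.2
    simp only [add_dotProduct, dotProduct_add, smul_dotProduct, dotProduct_smul, smul_eq_mul,
      single_one_dotProduct, dotProduct_single_one, Pi.add_apply, Pi.smul_apply,
      Pi.single_eq_same] at this
    linear_combination -this
  rw [householder, smul_sub, smul_smul, hw]
  by_cases h₀ : w 0 = 0
  · rw [h₀, mul_zero, neg_zero, dotProduct_self_eq_zero] at hw
    simp [hw]
  · have : r * (2 * w 0 / -(2 * r * w 0)) = -1 := by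
      have := hr.1.ne'
      field_simp
    rw [this, neg_one_smul, sub_neg_eq_add, add_comm w]

theorem closing_image_germSet_of_isConvexPolytope (hF : ∀ x ∈ F, √(1 + x ^ 2) ∈ F)
    {C : Set (Space F d)} (h : IsConvexPolytope C) (hne : C.Nonempty) (hrank : rank C = d) :
    closing '' germSet C = C := by
  obtain ⟨-, Ξ, hΞ, rfl⟩ := h
  obtain ⟨c, hcC, hc⟩ := exists_forall_pos_of_rank_eq hne (convex_biInter_closedHalfSpace Ξ)
    hrank hΞ fun ξ hξ x hx => mem_iInter₂.1 hx ξ hξ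
  rw [germSet_biInter_closedHalfSpace hΞ]
  refine Subset.antisymm (image_subset_iff.2 fun z hz => mem_iInter₂.2 fun ξ hξ =>
    nonneg_of_mem_refinedHalfSpace (mem_iInter₂.1 hz ξ hξ)) fun x hx => ?_
  rcases eq_or_ne c x with rfl | hxc
  · obtain ⟨ρ⟩ : Nonempty (Resolution F d) := inferInstance
    exact ⟨(c, ρ), mem_iInter₂.2 fun ξ hξ =>
      lexPos_refineFunctional_iff.2 (lexPos_cons.2 (.inl (hc ξ hξ))), rfl⟩
  -- A frame at `x` whose first vector points towards the interior point `c`.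
  obtain _ | n := d
  · exact absurd (Subsingleton.elim c x) hxc
  obtain ⟨ρ, r, hr, hρ⟩ := exists_resolution_smul_eq hF (sub_ne_zero.2 hxc)
  refine ⟨(x, ρ), mem_iInter₂.2 fun ξ hξ => lexPos_refineFunctional_iff.2 ?_, rfl⟩
  refine lexPos_cons.2 ((mem_iInter₂.1 hx ξ hξ).lt_or_eq.imp id fun h => ⟨h.symm, 0, ?_, ?_⟩)
  · have hpos := hc ξ hξ
    rw [← add_sub_cancel x c, apply_add, ← h, zero_add, hρ, map_smul, smul_eq_mul] at hpos
    exact (mul_pos_iff_of_pos_left hr).1 hpos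
  · simp

theorem refinement_eq_germSet (hF : ∀ x ∈ F, √(1 + x ^ 2) ∈ F) {P : Set (Space F d)}
    (hP : IsPolytope d P) : refinement P = germSet P := by
  have hex : ∃ S ∈ {S : Set (RefinedSpace F d) | IsRefinedPolytope S}, closing '' S = P := by
    obtain ⟨𝒞, hf, hC, rfl⟩ := hP
    refine ⟨⋃₀ (germSet '' 𝒞), ⟨_, hf.image _, forall_mem_image.2 fun C hC' => ?_, rfl⟩, ?_⟩
    · obtain ⟨-, Ξ, hΞ, rfl⟩ := (hC C hC').1
      exact ⟨Ξ, hΞ, germSet_biInter_closedHalfSpace hΞ⟩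
    · rw [sUnion_image, image_iUnion₂, sUnion_eq_biUnion]
      exact iUnion₂_congr fun C h =>
        closing_image_germSet_of_isConvexPolytope hF (hC C h).1 (hC C h).2.1 (hC C h).2.2
  obtain ⟨P', hP', h⟩ :=
    IsRefinedPolytope.exists_eq_germSet (Function.invFunOn_mem hex)
  have heq : closing '' germSet P' = P := h ▸ Function.invFunOn_eq hex
  obtain ⟨ρ⟩ : Nonempty (Resolution F d) := inferInstance
  have hPP' := closing_image_germSet_eventuallyEq hP' ρ
  rw [heq] at hPP'
  exact h.trans (germSet_congr hPP').symm

/-! ### Lebesgue measure -/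

/-- The inclusion of `F ^ d` in `ℝ ^ d`. -/
def toReal (x : Space F d) : Fin d → ℝ := fun i => x i

/-- The Lebesgue measure of the figure in `ℝ ^ d` spanned by a subset of `F ^ d`. For `d = 2` it is
the `area`, by definition. -/
def content (S : Set (Space F d)) : ENNReal :=
  volume (closure (toReal '' S))

theorem content_mono {S T : Set (Space F d)} (h : S ⊆ T) : content S ≤ content T :=
  measure_mono (closure_mono (image_mono h))

theorem content_union_le (S T : Set (Space F d)) : content (S ∪ T) ≤ content S + content T := by
  rw [content, image_union, closure_union]
  exact measure_union_le _ _

theorem toReal_dotProduct (x y : Space F d) : toReal x ⬝ᵥ toReal y = ((x ⬝ᵥ y : F) : ℝ) := by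
  simp [toReal, dotProduct]

theorem exists_real_extension (ξ : Space F d →ᵃ[F] F) :
    ∃ f : (Fin d → ℝ) →ᵃ[ℝ] ℝ, ∀ x, f (toReal x) = ξ x := by
  obtain ⟨a, c, rfl⟩ := exists_eq_affineFunctional ξ
  refine ⟨(dotProductBilin ℝ ℝ (toReal a)).toAffineMap + AffineMap.const ℝ _ (c : ℝ), fun x => ?_⟩
  change toReal a ⬝ᵥ toReal x + c = ((a ⬝ᵥ x + c : F) : ℝ)
  rw [toReal_dotProduct, Subfield.coe_add]

theorem volume_real_extension_eq_zero {ξ : Space F d →ᵃ[F] F} (hξ : Regular ξ)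
    {f : (Fin d → ℝ) →ᵃ[ℝ] ℝ} (hf : ∀ x, f (toReal x) = ξ x) : volume {y | f y = 0} = 0 := by
  refine Measure.addHaar_affineSubspace volume ((AffineSubspace.mk' (0 : ℝ) ⊥).comap f)
    (fun htop => ?_) |>.symm.trans (congrArg _ (Set.ext fun y => ?_)) |>.symm
  · have h₀ : ∀ x, ξ x = 0 := fun x => by
      have : toReal x ∈ (AffineSubspace.mk' (0 : ℝ) ⊥).comap f :=
        htop ▸ AffineSubspace.mem_top ℝ _ _
      simpa [AffineSubspace.mem_comap, hf] using this
    obtain ⟨v, hv⟩ := hξ.exists_linear_ne_zero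
    exact hv (by simpa [h₀] using (apply_add ξ 0 v).symm)
  · simp

/-- The filter of complements of sets of content zero. -/
def conull (F : Subfield ℝ) (d : ℕ) : Filter (Space F d) :=
  .comk (fun S => content S = 0) (by simp [content])
    (fun _ hT _ hS => measure_mono_null (closure_mono (image_mono hS)) hT)
    fun S hS T hT => le_antisymm ((content_union_le S T).trans (by rw [hS, hT, add_zero])) zero_le

theorem conull_le_generic : conull F d ≤ generic F d := by
  refine le_iInf₂ fun ξ hξ => le_principal_iff.2 (mem_comk.2 ?_)
  obtain ⟨f, hf⟩ := exists_real_extension ξ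
  have hcont := f.continuous_of_finiteDimensional
  refine measure_mono_null (closure_minimal ?_ (isClosed_eq hcont continuous_const))
    (volume_real_extension_eq_zero hξ hf)
  rintro _ ⟨x, hx, rfl⟩
  rw [mem_ofPred_eq, hf, not_not.1 hx, Subfield.coe_zero]

theorem content_eq_zero_of_eventually_notMem {S : Set (Space F d)}
    (h : ∀ᶠ x in generic F d, x ∉ S) : content S = 0 := by
  have := mem_comk.1 (conull_le_generic h)
  rwa [compl_ofPred, show {x | ¬x ∉ S} = S from Set.ext fun x => not_not] at this

theorem content_le_of_eventually {S T : Set (Space F d)}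
    (h : ∀ᶠ x in generic F d, x ∈ S → x ∈ T) : content S ≤ content T := by
  have h₀ : content (S \ T) = 0 := content_eq_zero_of_eventually_notMem
    (h.mono fun x hx hST => hST.2 (hx hST.1))
  calc content S ≤ content (T ∪ S \ T) :=
        content_mono (by rw [union_sdiff_self]; exact subset_union_right)
    _ ≤ content T + content (S \ T) := content_union_le _ _
    _ = content T := by rw [h₀, add_zero]

theorem eventually_sign_eq {X : Type*} [TopologicalSpace X] {f : X → ℝ} (hf : Continuous f)
    {x : X} (hx : f x ≠ 0) : ∀ᶠ y in nhds x, SignType.sign (f y) = SignType.sign (f x) :=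
  ((continuousAt_sign_of_ne_zero hx).comp hf.continuousAt).preimage_mem_nhds
    ((isOpen_discrete {SignType.sign (f x)}).mem_nhds rfl)

theorem sign_coe (x : F) : SignType.sign (x : ℝ) = SignType.sign x :=
  StrictMono.sign_comp (f := F.subtype) (Subtype.strictMono_coe _) x

theorem Polyhedral.volume_closure_inter_eq_zero {S T : Set (Space F d)} (hS : Polyhedral S)
    (h : ∀ᶠ x in generic F d, x ∉ S ∩ T) :
    volume (closure (toReal '' S) ∩ closure (toReal '' T)) = 0 := by
  obtain ⟨Ξ, hf, hr, hS⟩ := hS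
  choose f hfξ using exists_real_extension (F := F) (d := d)
  -- Off the finitely many hyperplanes, `S` is locally everything or nothing.
  have hsub : closure (toReal '' S) ∩ closure (toReal '' T) ⊆
      closure (toReal '' (S ∩ T)) ∪ ⋃ ξ ∈ Ξ, {y | f ξ y = 0} := by
    rintro y ⟨hyS, hyT⟩
    refine or_iff_not_imp_right.2 fun hy => ?_
    simp only [mem_iUnion, mem_ofPred_eq, not_exists] at hy
    have hU : ∀ᶠ w in nhds y, ∀ ξ ∈ Ξ, SignType.sign (f ξ w) = SignType.sign (f ξ y) :=
      (eventually_all_finite hf).2 fun ξ hξ =>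
        eventually_sign_eq (f ξ).continuous_of_finiteDimensional (hy ξ hξ)
    obtain ⟨_, ⟨x, hxS, rfl⟩, hx⟩ :=
      ((mem_closure_iff_frequently.1 hyS).and_eventually hU).exists
    refine mem_closure_iff_frequently.2
      (((mem_closure_iff_frequently.1 hyT).and_eventually hU).mono ?_)
    rintro _ ⟨⟨x', hx', rfl⟩, hx''⟩
    refine ⟨x', ⟨(hS x x' fun ξ hξ => ?_).1 hxS, hx'⟩, rfl⟩
    rw [← sign_coe, ← sign_coe, ← hfξ, ← hfξ, hx ξ hξ, hx'' ξ hξ]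
  refine measure_mono_null hsub (measure_union_null
    (content_eq_zero_of_eventually_notMem h) ?_)
  exact (measure_biUnion_null_iff hf.countable).2 fun ξ hξ =>
    volume_real_extension_eq_zero (hr ξ hξ) (hfξ ξ)

/-- Up to finitely many hyperplanes, `S` is the disjoint union of the sets `A i`. -/
def GenericPartition {ι : Type*} (S : Set (Space F d)) (A : ι → Set (Space F d)) : Prop :=
  ∀ᶠ x in generic F d, (∀ i j, x ∈ A i → x ∈ A j → i = j) ∧ (x ∈ S ↔ ∃ i, x ∈ A i)

theorem GenericPartition.content_eq {ι : Type*} [Fintype ι] {S : Set (Space F d)}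
    {A : ι → Set (Space F d)} (h : GenericPartition S A) (hA : ∀ i, Polyhedral (A i)) :
    content S = ∑ i, content (A i) := by
  have hU : content S = content (⋃ i, A i) := le_antisymm
    (content_le_of_eventually (h.mono fun x hx hS => mem_iUnion.2 (hx.2.1 hS)))
    (content_le_of_eventually (h.mono fun x hx hS => hx.2.2 (mem_iUnion.1 hS)))
  rw [hU, content, image_iUnion, closure_iUnion_of_finite, measure_iUnion₀, tsum_fintype]
  · rfl
  · exact fun i j hij => (hA i).volume_closure_inter_eq_zero
      (h.mono fun x hx hxA => hij (hx.1 i j hxA.1 hxA.2))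
  · exact fun i => isClosed_closure.measurableSet.nullMeasurableSet

theorem exists_resolution_of_distance_preserving {g : Space F d → Space F d}
    (hg : ∀ x y, (g x - g y) ⬝ᵥ (g x - g y) = (x - y) ⬝ᵥ (x - y)) :
    ∃ ρ : Resolution F d, ∀ x, g x = (Matrix.of ρ.1).transpose.mulVec x + g 0 := by
  have hdot : ∀ x y, (g x - g 0) ⬝ᵥ (g y - g 0) = x ⬝ᵥ y := by
    intro x y
    have hx := hg x 0
    have hy := hg y 0
    have hxy := hg x y
    rw [← sub_sub_sub_cancel_right (g x) (g y) (g 0)] at hxy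
    simp only [sub_zero] at hx hy
    generalize g x - g 0 = u at *
    generalize g y - g 0 = v at *
    simp only [sub_dotProduct, dotProduct_sub, hx, hy, dotProduct_comm v u,
      dotProduct_comm y x] at hxy
    linear_combination -hxy / 2
  let ρ : Resolution F d := ⟨fun i => g (Pi.single i 1) - g 0, fun i j => by
    simp [hdot, Pi.single_apply, eq_comm]⟩
  refine ⟨ρ, fun x => ?_⟩
  rw [← sub_eq_iff_eq_add]
  calc g x - g 0 = ∑ i, (ρ.1 i ⬝ᵥ (g x - g 0)) • ρ.1 i := (ρ.sum_dotProduct_smul _).symm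
    _ = ∑ i, x i • ρ.1 i := by simp only [ρ, hdot, single_one_dotProduct]
    _ = (Matrix.of ρ.1).transpose.mulVec x := by
      rw [Matrix.mulVec_eq_sum]
      simp only [op_smul_eq_smul]
      rfl

theorem toReal_mulVec (A : Matrix (Fin d) (Fin d) F) (x : Space F d) :
    toReal (A.mulVec x) = (A.map F.subtype).mulVec (toReal x) :=
  funext fun i => by simp [toReal, Matrix.mulVec, dotProduct]

theorem Resolution.abs_det_transpose_map (ρ : Resolution F d) :
    |((Matrix.of ρ.1).transpose.map F.subtype).det| = 1 := by
  have h : (Matrix.of ρ.1).det * (Matrix.of ρ.1).det = 1 := by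
    simpa using congrArg Matrix.det ρ.toMatrix_mul_transpose
  rw [← RingHom.mapMatrix_apply, ← RingHom.map_det, Matrix.det_transpose, abs_eq zero_le_one]
  exact mul_self_eq_one_iff.1 (by rw [← map_mul, h, map_one])

theorem Congruent.content_eq {P Q : Set (Space F d)} (h : Congruent P Q) :
    content P = content Q := by
  obtain ⟨g, hg, rfl⟩ := h
  obtain ⟨ρ, hρ⟩ := exists_resolution_of_distance_preserving hg
  set L := Matrix.toLin' ((Matrix.of ρ.1).transpose.map F.subtype) with hL
  have hdet : |LinearMap.det L| = 1 := by rw [hL, LinearMap.det_toLin', ρ.abs_det_transpose_map]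
  have hdet₀ : LinearMap.det L ≠ 0 := fun h => by simp [h] at hdet
  let e : (Fin d → ℝ) ≃L[ℝ] (Fin d → ℝ) := (L.equivOfDetNeZero hdet₀).toContinuousLinearEquiv
  have himage : toReal '' (g '' P) =
      Homeomorph.addRight (toReal (g 0)) '' (e '' (toReal '' P)) := by
    simp only [image_image]
    refine image_congr fun x _ => ?_
    rw [hρ]
    exact congrArg (· + toReal (g 0)) (toReal_mulVec _ x)
  have hvol : volume (e '' closure (toReal '' P)) = content P := by
    change volume (L '' closure (toReal '' P)) = content P
    rw [Measure.addHaar_image_linearMap, hdet, ENNReal.ofReal_one, one_mul, content]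
  rw [← hvol, content, himage, ← Homeomorph.image_closure, ← e.image_closure,
    Homeomorph.coe_addRight, image_add_right, measure_preimage_add_right]

/-! ### Boxes -/

/-- The half-open box `∏ᵢ [aᵢ, bᵢ)`. -/
def box (a b : Space F d) : Set (Space F d) := univ.pi fun i => Ico (a i) (b i)

theorem mem_box {a b x : Space F d} : x ∈ box a b ↔ ∀ i, a i ≤ x i ∧ x i < b i :=
  mem_univ_pi

theorem denseRange_coe : DenseRange ((↑) : F → ℝ) := by
  refine Dense.mono ?_ (Rat.denseRange_cast (𝕜 := ℝ))
  rintro _ ⟨q, rfl⟩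
  exact ⟨q, by simp⟩

theorem closure_image_coe_Ico {a b : F} (hab : a < b) :
    closure (((↑) : F → ℝ) '' Ico a b) = Icc (a : ℝ) b := by
  refine Subset.antisymm (closure_minimal ?_ isClosed_Icc) ?_
  · rintro _ ⟨x, hx, rfl⟩
    exact ⟨hx.1, le_of_lt hx.2⟩
  · rw [← closure_Ioo (show (a : ℝ) < b from hab).ne]
    refine closure_minimal
      (((denseRange_coe (F := F)).open_subset_closure_inter isOpen_Ioo).trans (closure_mono ?_))
      isClosed_closure
    rintro _ ⟨hx, x, rfl⟩
    exact ⟨x, ⟨le_of_lt hx.1, hx.2⟩, rfl⟩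

theorem volume_closure_image_coe_Ico {a b : F} :
    volume (closure (((↑) : F → ℝ) '' Ico a b)) = ENNReal.ofReal (b - a) := by
  rcases lt_or_ge a b with hab | hab
  · rw [closure_image_coe_Ico hab, Real.volume_Icc]
  · rw [Ico_eq_empty hab.not_gt, image_empty, closure_empty, measure_empty,
      ENNReal.ofReal_of_nonpos (sub_nonpos.2 hab)]

theorem content_box (a b : Space F d) :
    content (box a b) = ∏ i, ENNReal.ofReal (b i - a i) := by
  have himage : toReal '' box a b = univ.pi fun i => ((↑) : F → ℝ) '' Ico (a i) (b i) :=
    (piMap_image_univ_pi (fun _ => ((↑) : F → ℝ)) fun i => Ico (a i) (b i))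
  rw [content, himage, closure_pi_set, volume_pi_pi]
  exact Finset.prod_congr rfl fun i _ => volume_closure_image_coe_Ico

theorem polyhedral_setOf_le_apply (i : Fin d) (c : F) :
    Polyhedral {x : Space F d | c ≤ x i} := by
  have h : {x : Space F d | c ≤ x i} =
      closedHalfSpace (affineFunctional (Pi.single i 1) (-c)) := by
    ext x
    simp [closedHalfSpace]
  exact h ▸ polyhedral_closedHalfSpace (regular_affineFunctional (by simp) _)

theorem polyhedral_box (a b : Space F d) : Polyhedral (box a b) := by
  have h : box a b = ⋂ i, {x | a i ≤ x i} ∩ {x | b i ≤ x i}ᶜ := by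
    ext x
    simp [mem_box]
  exact h ▸ .iInter fun i =>
    (polyhedral_setOf_le_apply i _).inter (polyhedral_setOf_le_apply i _).compl

theorem isBounded_box (a b : Space F d) : Bornology.IsBounded (box a b) :=
  .pi fun i => isometry_subtype_coe.antilipschitz.isBounded_preimage
    (Metric.isBounded_Ico (a i : ℝ) (b i))

/-! ### Generic partitions -/

theorem mem_image_affineEquiv {φ : Space F d ≃ᵃ[F] Space F d} {S : Set (Space F d)}
    {x : Space F d} : x ∈ φ '' S ↔ φ.symm x ∈ S :=
  φ.toEquiv.image_eq_preimage_symm S ▸ Iff.rfl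

theorem genericPartition_const {ι : Type*} [Unique ι] (S : Set (Space F d)) :
    GenericPartition S fun _ : ι => S :=
  .of_forall fun x => ⟨fun _ _ _ _ => Subsingleton.elim _ _, by simp⟩

theorem genericPartition_union {S T : Set (Space F d)} (h : ∀ᶠ x in generic F d, x ∈ S → x ∉ T) :
    GenericPartition (S ∪ T) fun b : Bool => cond b S T := by
  filter_upwards [h] with x hx
  simpa [or_comm] using ⟨fun hT hS => hx hS hT, hx⟩

namespace GenericPartition

variable {ι κ : Type*} {S T : Set (Space F d)} {A : ι → Set (Space F d)}

theorem congr_left (h : GenericPartition S A) (hST : S =ᶠ[generic F d] T) :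
    GenericPartition T A := by
  filter_upwards [h, hST.mem_iff] with x hx hx'
  exact ⟨hx.1, hx'.symm.trans hx.2⟩

theorem image (h : GenericPartition S A) (φ : Space F d ≃ᵃ[F] Space F d) :
    GenericPartition (φ '' S) fun i => φ '' A i := by
  filter_upwards [(tendsto_generic φ.symm).eventually h] with x hx
  simpa only [mem_image_affineEquiv] using hx

theorem reindex (h : GenericPartition S A) (e : κ ≃ ι) :
    GenericPartition S fun k => A (e k) := by
  filter_upwards [h] with x hx
  exact ⟨fun i j hi hj => e.injective (hx.1 _ _ hi hj),
    hx.2.trans (e.exists_congr fun _ => Iff.rfl).symm⟩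

theorem sigma [Finite ι] {κ : ι → Type*} {B : ∀ i, κ i → Set (Space F d)}
    (h : GenericPartition S A) (hB : ∀ i, GenericPartition (A i) (B i)) :
    GenericPartition S fun p : Σ i, κ i => B p.1 p.2 := by
  filter_upwards [h, eventually_all.2 hB] with x hx hxB
  constructor
  · rintro ⟨i, k⟩ ⟨j, l⟩ hi hj
    obtain rfl := hx.1 i j ((hxB i).2.2 ⟨k, hi⟩) ((hxB j).2.2 ⟨l, hj⟩)
    obtain rfl := (hxB i).1 k l hi hj
    rfl
  · rw [hx.2, Sigma.exists]
    exact exists_congr fun i => (hxB i).2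

theorem restrict {B : κ → Set (Space F d)} (h : GenericPartition S A) (hB : GenericPartition S B)
    (k : κ) : GenericPartition (B k) fun i => A i ∩ B k := by
  filter_upwards [h, hB] with x hx hxB
  refine ⟨fun i j hi hj => hx.1 i j hi.1 hj.1, fun hk => ?_, fun ⟨_, hi⟩ => hi.2⟩
  obtain ⟨i, hi⟩ := hx.2.1 (hxB.2.2 ⟨k, hk⟩)
  exact ⟨i, hi, hk⟩

end GenericPartition

/-! ### Scissors congruence by translations and point reflections -/

/-- The group of translations and point reflections. They are isometries, but, unlike the group of
all isometries, they form a normal subgroup of the affine group. -/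
def signedTranslations (F : Subfield ℝ) (d : ℕ) : Subgroup (Space F d ≃ᵃ[F] Space F d) where
  carrier := {g | ∃ ε : ℤˣ, ∀ v, g.linear v = ε • v}
  one_mem' := ⟨1, fun v => (one_smul _ v).symm⟩
  mul_mem' := by
    rintro g h ⟨ε, hg⟩ ⟨δ, hh⟩
    refine ⟨ε * δ, fun v => ?_⟩
    rw [mul_smul, ← hh, ← hg]
    rfl
  inv_mem' := by
    rintro g ⟨ε, hg⟩
    refine ⟨ε⁻¹, fun v => ?_⟩
    rw [eq_inv_smul_iff, ← hg]
    exact g.linear.apply_symm_apply v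

instance : (signedTranslations F d).Normal where
  conj_mem := by
    rintro g ⟨ε, hg⟩ φ
    refine ⟨ε, fun v => ?_⟩
    change φ.linear (g.linear (φ.linear.symm v)) = _
    rw [hg, Units.smul_def, map_zsmul, LinearEquiv.apply_symm_apply, Units.smul_def]

theorem congruent_image_of_mem_signedTranslations {g : Space F d ≃ᵃ[F] Space F d}
    (hg : g ∈ signedTranslations F d) (S : Set (Space F d)) : Congruent S (g '' S) := by
  obtain ⟨ε, hε⟩ := hg
  refine ⟨g.toEquiv, fun x y => ?_, rfl⟩
  have h : g x - g y = ε • (x - y) := (g.toAffineMap.linearMap_vsub x y).symm.trans (hε _)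
  change (g x - g y) ⬝ᵥ (g x - g y) = _
  rw [h]
  rcases Int.units_eq_one_or ε with rfl | rfl
  · simp only [one_smul]
  · simp only [Units.neg_smul, one_smul, neg_dotProduct_neg]

theorem isBounded_image {S : Set (Space F d)} (hS : Bornology.IsBounded S)
    (φ : Space F d ≃ᵃ[F] Space F d) : Bornology.IsBounded (φ '' S) := by
  obtain ⟨C, hC⟩ := hS.exists_norm_le
  refine isBounded_iff_forall_norm_le.2
    ⟨‖φ 0‖ + ∑ i, C * ‖φ.linear fun j => if i = j then 1 else 0‖, forall_mem_image.2 fun x hx => ?_⟩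
  have h : φ x = φ 0 + ∑ i, x i • φ.linear fun j => if i = j then 1 else 0 := by
    rw [← φ.linear.coe_coe, ← LinearMap.pi_apply_eq_sum_univ, add_comm]
    simpa using φ.map_vadd 0 x
  rw [h]
  refine norm_add_le_of_le le_rfl (norm_sum_le_of_le _ fun i _ => ?_)
  rw [norm_smul]
  gcongr
  exact (norm_le_pi_norm x i).trans (hC x hx)

/-- `S` and `T` can be cut into finitely many bounded polyhedral pieces such that corresponding
pieces are carried to each other by translations and point reflections. -/
def ScissorsCongruent (S T : Set (Space F d)) : Prop :=
  ∃ (ι : Type) (_ : Finite ι) (A : ι → Set (Space F d)) (g : ι → signedTranslations F d),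
    (∀ i, Polyhedral (A i) ∧ Bornology.IsBounded (A i)) ∧
      GenericPartition S A ∧ GenericPartition T fun i => (g i).1 '' A i

namespace ScissorsCongruent

variable {S T U : Set (Space F d)}

theorem of_image {g : Space F d ≃ᵃ[F] Space F d} (hg : g ∈ signedTranslations F d)
    (hS : Polyhedral S) (hb : Bornology.IsBounded S) : ScissorsCongruent S (g '' S) :=
  ⟨Unit, inferInstance, fun _ => S, fun _ => ⟨g, hg⟩, fun _ => ⟨hS, hb⟩,
    genericPartition_const S, genericPartition_const _⟩

theorem refl (hS : Polyhedral S) (hb : Bornology.IsBounded S) : ScissorsCongruent S S := by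
  simpa using of_image (one_mem (signedTranslations F d)) hS hb

theorem symm (h : ScissorsCongruent S T) : ScissorsCongruent T S := by
  obtain ⟨ι, _, A, g, hA, hS, hT⟩ := h
  refine ⟨ι, inferInstance, fun i => (g i).1 '' A i, fun i => (g i)⁻¹,
    fun i => ⟨(hA i).1.image _, isBounded_image (hA i).2 _⟩, hT, ?_⟩
  convert hS using 2 with i
  exact (g i).1.toEquiv.symm_image_image (A i)

theorem trans (h : ScissorsCongruent S T) (h' : ScissorsCongruent T U) :
    ScissorsCongruent S U := by
  obtain ⟨ι, _, A, g, hA, hT, hS⟩ := h.symm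
  obtain ⟨κ, _, B, f, hB, hT', hU⟩ := h'
  refine ⟨ι × κ, inferInstance, fun p => (g p.1).1 '' (A p.1 ∩ B p.2), fun p => f p.2 * (g p.1)⁻¹,
    fun p => ⟨((hA p.1).1.inter (hB p.2).1).image _,
      isBounded_image ((hA p.1).2.subset inter_subset_left) _⟩, ?_, ?_⟩
  · have hA' : ∀ i, GenericPartition (A i) fun k => A i ∩ B k := fun i => by
      simpa only [inter_comm] using hT'.restrict hT i
    exact (hS.sigma fun i => (hA' i).image (g i).1).reindex (Equiv.sigmaEquivProd ι κ).symm
  · convert (hU.sigma fun k => (hT.restrict hT' k).image (f k).1).reindex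
      ((Equiv.prodComm ι κ).trans (Equiv.sigmaEquivProd κ ι).symm) using 2 with p
    exact (image_comp (f p.2).1 (g p.1).1.symm _).trans
      (congrArg _ ((g p.1).1.toEquiv.symm_image_image _))

theorem congr {S' T' : Set (Space F d)} (h : ScissorsCongruent S T) (hS : S =ᶠ[generic F d] S')
    (hT : T =ᶠ[generic F d] T') : ScissorsCongruent S' T' := by
  obtain ⟨ι, _, A, g, hA, h₁, h₂⟩ := h
  exact ⟨ι, inferInstance, A, g, hA, h₁.congr_left hS, h₂.congr_left hT⟩

theorem image (h : ScissorsCongruent S T) (φ : Space F d ≃ᵃ[F] Space F d) :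
    ScissorsCongruent (φ '' S) (φ '' T) := by
  obtain ⟨ι, _, A, g, hA, hS, hT⟩ := h
  refine ⟨ι, inferInstance, fun i => φ '' A i,
    fun i => ⟨φ * (g i).1 * φ⁻¹, Subgroup.Normal.conj_mem inferInstance _ (g i).2 φ⟩,
    fun i => ⟨(hA i).1.image _, isBounded_image (hA i).2 _⟩, hS.image φ, ?_⟩
  convert hT.image φ using 2 with i
  rw [image_image, image_image]
  exact image_congr fun x _ => congr(φ ((g i).1 $(φ.symm_apply_apply x)))

theorem of_genericPartition {ι : Type} [Finite ι] {A B : ι → Set (Space F d)}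
    (hS : GenericPartition S A) (hT : GenericPartition T B)
    (h : ∀ i, ScissorsCongruent (A i) (B i)) : ScissorsCongruent S T := by
  choose κ _ C g hC hA hB using h
  exact ⟨Σ i, κ i, inferInstance, fun p => C p.1 p.2, fun p => g p.1 p.2,
    fun p => hC p.1 p.2, hS.sigma hA, hT.sigma hB⟩

theorem union {S' T' : Set (Space F d)} (h : ScissorsCongruent S T)
    (h' : ScissorsCongruent S' T') (hS : ∀ᶠ x in generic F d, x ∈ S → x ∉ S')
    (hT : ∀ᶠ x in generic F d, x ∈ T → x ∉ T') : ScissorsCongruent (S ∪ S') (T ∪ T') :=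
  of_genericPartition (genericPartition_union hS) (genericPartition_union hT)
    (Bool.forall_bool.2 ⟨h', h⟩)

theorem of_cut {H : Set (Space F d)} (hS : Polyhedral S) (hb : Bornology.IsBounded S)
    (hH : Polyhedral H) {g : Space F d ≃ᵃ[F] Space F d} (hg : g ∈ signedTranslations F d)
    (hdisj : ∀ᶠ x in generic F d, x ∈ S ∩ H → x ∉ g '' (S \ H)) :
    ScissorsCongruent S (S ∩ H ∪ g '' (S \ H)) := by
  have h := union (refl (hS.inter hH) (hb.subset inter_subset_left))
    (of_image hg (hS.inter hH.compl) (hb.subset inter_subset_left))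
    (.of_forall fun x hx hx' => hx'.2 hx.2) hdisj
  rwa [← sdiff_eq, inter_union_sdiff] at h

theorem content_eq (h : ScissorsCongruent S T) : content S = content T := by
  obtain ⟨ι, _, A, g, hA, hS, hT⟩ := h
  have := Fintype.ofFinite ι
  rw [hS.content_eq fun i => (hA i).1, hT.content_eq fun i => (hA i).1.image _]
  exact Finset.sum_congr rfl fun i _ =>
    (congruent_image_of_mem_signedTranslations (g i).2 _).content_eq

end ScissorsCongruent

/-! ### Parallelograms -/

/-- The invertible linear map `x ↦ A x` as an affine equivalence. -/
def affineEquivOfDet (A : Matrix (Fin d) (Fin d) F) (hA : A.det ≠ 0) :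
    Space F d ≃ᵃ[F] Space F d :=
  ((Matrix.toLin' A).equivOfDetNeZero (by rwa [LinearMap.det_toLin'])).toAffineEquiv

theorem ScissorsCongruent.image_mulVec {S T : Set (Space F d)} (h : ScissorsCongruent S T)
    {A : Matrix (Fin d) (Fin d) F} (hA : A.det ≠ 0) :
    ScissorsCongruent (A.mulVec '' S) (A.mulVec '' T) :=
  h.image (affineEquivOfDet A hA)

theorem constVAdd_mem_signedTranslations (v : Space F d) :
    AffineEquiv.constVAdd F (Space F d) v ∈ signedTranslations F d :=
  ⟨1, fun w => (one_smul _ w).symm⟩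

/-- The group of unimodular linear maps that carry the unit cube to a set that is scissors congruent
to it. -/
def cubeStabilizer (F : Subfield ℝ) (d : ℕ) : Subgroup (Matrix.SpecialLinearGroup (Fin d) F) where
  carrier := {A | ScissorsCongruent (A.1.mulVec '' box 0 1) (box 0 1)}
  one_mem' := by
    simpa using ScissorsCongruent.refl (polyhedral_box 0 1) (isBounded_box (F := F) 0 1)
  mul_mem' {A B} hA hB := by
    have h := (hB.image_mulVec A.det_ne_zero).trans hA
    simp only [image_image, Matrix.mulVec_mulVec] at h
    exact h
  inv_mem' {A} hA := by
    have h := (hA.image_mulVec A⁻¹.det_ne_zero).symm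
    have hinv : ∀ x, A⁻¹.1.mulVec (A.1.mulVec x) = x := fun x => by
      have hA' : A⁻¹.1 * A.1 = 1 := congrArg Subtype.val (inv_mul_cancel A)
      exact (Matrix.mulVec_mulVec _ _ _).trans (hA' ▸ Matrix.one_mulVec x)
    simp only [image_image, hinv, image_id'] at h
    exact h

theorem transvection_mulVec (i j : Fin d) (k : F) (x : Space F d) :
    (Matrix.transvection i j k).mulVec x = x + Pi.single i (k * x j) := by
  rw [Matrix.transvection, Matrix.add_mulVec, Matrix.one_mulVec, Matrix.single_mulVec]
  rfl

theorem mem_image_transvection {i j : Fin d} (hij : i ≠ j) {k : F} {S : Set (Space F d)}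
    {x : Space F d} : x ∈ (Matrix.transvection i j k).mulVec '' S ↔
      x + Pi.single i (-(k * x j)) ∈ S := by
  simp only [mem_image, transvection_mulVec]
  constructor
  · rintro ⟨y, hy, rfl⟩
    simpa [Pi.single_eq_of_ne hij.symm, add_assoc, ← Pi.single_add] using hy
  · intro h
    refine ⟨_, h, ?_⟩
    simp [Pi.single_eq_of_ne hij.symm, add_assoc, ← Pi.single_add]

theorem mem_unitCube_iff (i : Fin d) {x : Space F d} :
    x ∈ box (0 : Space F d) 1 ↔ (0 ≤ x i ∧ x i < 1) ∧ ∀ l ≠ i, 0 ≤ x l ∧ x l < 1 := by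
  rw [mem_box]
  exact ⟨fun h => ⟨h i, fun l _ => h l⟩, fun h l => (eq_or_ne l i).elim (· ▸ h.1) (h.2 l)⟩

theorem mem_image_transvection_unitCube {i j : Fin d} (hij : i ≠ j) {k : F} {x : Space F d} :
    x ∈ (Matrix.transvection i j k).mulVec '' box 0 1 ↔
      (0 ≤ x i - k * x j ∧ x i - k * x j < 1) ∧ ∀ l ≠ i, 0 ≤ x l ∧ x l < 1 := by
  rw [mem_image_transvection hij, mem_unitCube_iff i, Pi.add_apply, Pi.single_eq_same,
    ← sub_eq_add_neg]
  exact and_congr_right' (forall₂_congr fun l hl => by simp [hl])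

theorem mem_image_transvection_unitCube_inter_translate {i j : Fin d} (hij : i ≠ j) {k : F}
    (hk₁ : k ≤ 1) {x : Space F d} :
    x ∈ AffineEquiv.constVAdd F (Space F d) (-Pi.single i 1) ''
        ((Matrix.transvection i j k).mulVec '' box 0 1 \ {y | 1 ≤ y i}ᶜ) ↔
      (0 ≤ x i ∧ x i < k * x j) ∧ ∀ l ≠ i, 0 ≤ x l ∧ x l < 1 := by
  set g := AffineEquiv.constVAdd F (Space F d) (-Pi.single i 1)
  have hx : g.symm x = x + Pi.single i 1 := by simp [g, add_comm]
  have hi : g.symm x i = x i + 1 := by simp [hx]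
  have hl : ∀ l ≠ i, g.symm x l = x l := fun l hl => by simp [hx, hl]
  rw [mem_image_affineEquiv, Set.mem_sdiff, mem_image_transvection_unitCube hij, notMem_compl_iff,
    mem_ofPred_eq, forall₂_congr fun l h => by rw [hl l h], hi, hl j hij.symm, and_right_comm]
  refine and_congr_left fun h => ?_
  have hkx : k * x j ≤ 1 := mul_le_one₀ hk₁ (h j hij.symm).1 (h j hij.symm).2.le
  constructor <;> grind

theorem transvection_mem_cubeStabilizer_of_le_one {i j : Fin d} (hij : i ≠ j) {k : F}
    (hk₀ : 0 ≤ k) (hk₁ : k ≤ 1) :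
    Matrix.SpecialLinearGroup.transvection hij k ∈ cubeStabilizer F d := by
  -- Cut the slanted cube along `xᵢ = 1` and move the protruding part back by one unit.
  let A := Matrix.SpecialLinearGroup.transvection hij k
  let S : Set (Space F d) := A.1.mulVec '' box 0 1
  let H : Set (Space F d) := {x | 1 ≤ x i}ᶜ
  let g := AffineEquiv.constVAdd F (Space F d) (-Pi.single i 1)
  have hS : ∀ x, x ∈ S ↔ (0 ≤ x i - k * x j ∧ x i - k * x j < 1) ∧ ∀ l ≠ i, 0 ≤ x l ∧ x l < 1 :=
    fun x => mem_image_transvection_unitCube hij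
  have hg : ∀ x, x ∈ g '' (S \ H) ↔ (0 ≤ x i ∧ x i < k * x j) ∧ ∀ l ≠ i, 0 ≤ x l ∧ x l < 1 :=
    fun x => mem_image_transvection_unitCube_inter_translate hij hk₁
  have hcut : ScissorsCongruent S (S ∩ H ∪ g '' (S \ H)) := .of_cut
    ((polyhedral_box 0 1).image (affineEquivOfDet _ A.det_ne_zero))
    (isBounded_image (isBounded_box 0 1) (affineEquivOfDet _ A.det_ne_zero))
    (polyhedral_setOf_le_apply i 1).compl (constVAdd_mem_signedTranslations _)
    (.of_forall fun x hx hx' =>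
      (((hg x).1 hx').1.2.trans_le (sub_nonneg.1 ((hS x).1 hx.1).1.1)).false)
  have hbox : S ∩ H ∪ g '' (S \ H) = box 0 1 := by
    ext x
    rw [mem_union, mem_inter_iff, hS, hg, and_right_comm, ← or_and_right, mem_unitCube_iff i,
      mem_compl_iff, mem_ofPred_eq, not_le]
    refine and_congr_left fun h => ?_
    have hkx : 0 ≤ k * x j := mul_nonneg hk₀ (h j hij.symm).1
    have hkx' : k * x j < 1 := mul_lt_one_of_nonneg_of_lt_one_right hk₁ (h j hij.symm).1
      (h j hij.symm).2
    grind
  exact (congrArg (ScissorsCongruent S) hbox).mp hcut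

theorem transvection_mem_cubeStabilizer {i j : Fin d} (hij : i ≠ j) (k : F) :
    Matrix.SpecialLinearGroup.transvection hij k ∈ cubeStabilizer F d := by
  wlog hk : 0 ≤ k generalizing k
  · rw [← inv_mem_iff, Matrix.SpecialLinearGroup.transvection_inv]
    exact this _ (neg_nonneg.2 (le_of_not_ge hk))
  obtain ⟨n, hn⟩ := exists_nat_gt k
  have hn₀ : (n : F) ≠ 0 := (hk.trans_lt hn).ne'
  have hmul : ∀ m : ℕ, .transvection hij (m * (k / n)) ∈ cubeStabilizer F d := by
    intro m
    induction m with
    | zero => simp [one_mem]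
    | succ m ih =>
      rw [Nat.cast_succ, add_one_mul, Matrix.SpecialLinearGroup.transvection_add]
      exact mul_mem ih (transvection_mem_cubeStabilizer_of_le_one hij (by positivity)
        (div_le_one_of_le₀ hn.le (by positivity)))
  simpa [mul_div_cancel₀ _ hn₀] using hmul n

theorem eq_transvection_mul_transvection_mul_transvection {K : Type*} [Field K]
    (A : Matrix.SpecialLinearGroup (Fin 2) K) (hA : A.1 1 0 ≠ 0) :
    A = .transvection zero_ne_one ((A.1 0 0 - 1) / A.1 1 0) * .transvection one_ne_zero (A.1 1 0) *
      .transvection zero_ne_one ((A.1 1 1 - 1) / A.1 1 0) := by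
  have hdet := A.2
  rw [Matrix.det_fin_two] at hdet
  refine Subtype.ext (Matrix.ext fun i j => ?_)
  rw [Matrix.SpecialLinearGroup.coe_mul, Matrix.SpecialLinearGroup.coe_mul]
  fin_cases i <;> fin_cases j <;>
    simp [Matrix.SpecialLinearGroup.transvection_coe, Matrix.mul_apply, Fin.sum_univ_two, hA,
      mul_div_cancel₀]
  field_simp
  linear_combination -hdet

theorem cubeStabilizer_two_eq_top : cubeStabilizer F 2 = ⊤ := by
  have hne : ∀ A : Matrix.SpecialLinearGroup (Fin 2) F, A.1 1 0 ≠ 0 → A ∈ cubeStabilizer F 2 := by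
    intro A hA
    rw [eq_transvection_mul_transvection_mul_transvection A hA]
    exact mul_mem (mul_mem (transvection_mem_cubeStabilizer _ _)
      (transvection_mem_cubeStabilizer _ _)) (transvection_mem_cubeStabilizer _ _)
  refine eq_top_iff.2 fun A _ => ?_
  by_cases hA : A.1 1 0 = 0
  · refine (mul_mem_cancel_left (transvection_mem_cubeStabilizer one_ne_zero 1)).1 (hne _ ?_)
    have hdet := A.2
    rw [Matrix.det_fin_two, hA, mul_zero, sub_zero] at hdet
    rw [Matrix.SpecialLinearGroup.coe_mul]
    simpa [Matrix.SpecialLinearGroup.transvection_coe, Matrix.add_mul, hA] using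
      left_ne_zero_of_mul_eq_one hdet
  · exact hne A hA

theorem ScissorsCongruent.image_mulVec_unitCube {A B : Matrix (Fin 2) (Fin 2) F} (hA : A.det ≠ 0)
    (h : A.det = B.det) : ScissorsCongruent (A.mulVec '' box 0 1) (B.mulVec '' box 0 1) := by
  have hB : B.det ≠ 0 := h ▸ hA
  have hdet : (B⁻¹ * A).det = 1 := by
    rw [Matrix.det_mul, h, Matrix.det_nonsing_inv, Ring.inverse_mul_cancel _ hB.isUnit]
  have hmem : ⟨B⁻¹ * A, hdet⟩ ∈ cubeStabilizer F 2 :=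
    cubeStabilizer_two_eq_top (F := F) ▸ Subgroup.mem_top _
  have himage := ScissorsCongruent.image_mulVec hmem hB
  simp only [image_image, Matrix.mulVec_mulVec, Matrix.mul_nonsing_inv_cancel_left _ _ hB.isUnit]
    at himage
  exact himage

theorem image_diagonal_mulVec_unitCube {w : Space F d} (hw : ∀ i, 0 < w i) :
    (Matrix.diagonal w).mulVec '' box 0 1 = box 0 w := by
  ext x
  simp only [mem_image, mem_box, Pi.zero_apply, Pi.one_apply]
  constructor
  · rintro ⟨y, hy, rfl⟩ i
    rw [Matrix.mulVec_diagonal]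
    exact ⟨mul_nonneg (hw i).le (hy i).1, mul_lt_of_lt_one_right (hw i) (hy i).2⟩
  · refine fun h => ⟨fun i => x i / w i, fun i => ?_, funext fun i => ?_⟩
    · exact ⟨div_nonneg (h i).1 (hw i).le, (div_lt_one (hw i)).2 (h i).2⟩
    · rw [Matrix.mulVec_diagonal, mul_div_cancel₀ _ (hw i).ne']

/-- The rectangle `[0, 1) × [0, r)`. -/
def rectangle (r : F) : Set (Space F 2) := box 0 ![1, r]

theorem image_swap_unitCube : (!![0, 1; 1, 0] : Matrix (Fin 2) (Fin 2) F).mulVec '' box 0 1 =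
    box 0 1 := by
  have hswap : ∀ x, (!![0, 1; 1, 0] : Matrix (Fin 2) (Fin 2) F).mulVec x = ![x 1, x 0] :=
    fun x => funext (Fin.forall_fin_two.2 (by simp [Matrix.mulVec, dotProduct]))
  rw [Function.Involutive.image_eq_preimage_symm fun x => by
    rw [hswap, hswap]; exact funext (Fin.forall_fin_two.2 ⟨rfl, rfl⟩)]
  ext x
  simp [hswap, mem_box, and_comm]

theorem exists_scissorsCongruent_rectangle_of_image_mulVec {A : Matrix (Fin 2) (Fin 2) F}
    (hA : A.det ≠ 0) : ∃ r : F, 0 < r ∧ ScissorsCongruent (A.mulVec '' box 0 1) (rectangle r) := by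
  wlog hpos : 0 < A.det generalizing A
  · have hdet : (A * !![0, 1; 1, 0]).det = -A.det := by simp
    have hneg : 0 < (A * !![0, 1; 1, 0]).det :=
      hdet ▸ neg_pos.2 (lt_of_le_of_ne (not_lt.1 hpos) hA)
    rw [← image_swap_unitCube, image_image]
    simp only [Matrix.mulVec_mulVec]
    exact this hneg.ne' hneg
  refine ⟨A.det, hpos, ?_⟩
  have hw : ∀ i, 0 < ![1, A.det] i := Fin.forall_fin_two.2 ⟨one_pos, hpos⟩
  rw [rectangle, ← image_diagonal_mulVec_unitCube hw]
  exact .image_mulVec_unitCube hA (by simp)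

theorem exists_scissorsCongruent_rectangle_of_image (φ : Space F 2 ≃ᵃ[F] Space F 2) :
    ∃ r : F, 0 < r ∧ ScissorsCongruent (φ '' box 0 1) (rectangle r) := by
  let A := LinearMap.toMatrix' φ.linear.toLinearMap
  have hA : A.det ≠ 0 := by
    rw [LinearMap.det_toMatrix']
    exact φ.linear.isUnit_det'.ne_zero
  have himage : φ '' box 0 1 =
      AffineEquiv.constVAdd F (Space F 2) (φ 0) '' (affineEquivOfDet A hA '' box 0 1) := by
    rw [image_image]
    refine image_congr fun x _ => ?_
    have hlin : A.mulVec x = φ.linear x := LinearMap.toMatrix'_mulVec _ x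
    have hφ := φ.map_vadd 0 x
    rw [vadd_eq_add, vadd_eq_add, add_zero, ← hlin, add_comm] at hφ
    exact hφ
  obtain ⟨r, hr, h⟩ := exists_scissorsCongruent_rectangle_of_image_mulVec hA
  refine ⟨r, hr, .trans (.symm ?_) h⟩
  rw [himage]
  exact .of_image (constVAdd_mem_signedTranslations _)
    ((polyhedral_box 0 1).image (affineEquivOfDet A hA))
    (isBounded_image (isBounded_box 0 1) (affineEquivOfDet A hA))

/-! ### Simplices -/

/-- The (unordered) vertices of a nondegenerate simplex of full dimension. -/
abbrev SimplexBasis (F : Subfield ℝ) (d : ℕ) : Type :=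
  AffineBasis (Fin (d + 1)) F (Space F d)

/-- The closed simplex whose vertices are the points of `b`, described by the barycentric
coordinates. -/
def simplex (b : SimplexBasis F d) : Set (Space F d) :=
  {x | ∀ k, 0 ≤ b.coord k x}

theorem mem_simplex {b : SimplexBasis F d} {x : Space F d} :
    x ∈ simplex b ↔ ∀ k, 0 ≤ b.coord k x := Iff.rfl

theorem apply_eq_sum_coord (ξ : Space F d →ᵃ[F] F) (b : SimplexBasis F d) (x : Space F d) :
    ξ x = ∑ k, b.coord k x * ξ (b k) := by
  conv_lhs => rw [← b.affineCombination_coord_eq_self x,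
    Finset.map_affineCombination _ _ _ (b.sum_coord_apply_eq_one x),
    Finset.affineCombination_eq_linear_combination _ _ _ (b.sum_coord_apply_eq_one x)]
  rfl

theorem vertex_mem_simplex (b : SimplexBasis F d) (k : Fin (d + 1)) : b k ∈ simplex b := fun j => by
  rw [b.coord_apply]
  split_ifs <;> simp

theorem isBounded_simplex (b : SimplexBasis F d) : Bornology.IsBounded (simplex b) := by
  refine isBounded_iff_forall_norm_le.2 ⟨∑ k, 1 * ‖b k‖, fun x hx => ?_⟩
  rw [← b.linear_combination_coord_eq_self x]
  refine norm_sum_le_of_le _ fun k _ => ?_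
  have hk : b.coord k x ≤ 1 := b.sum_coord_apply_eq_one x ▸
    Finset.single_le_sum (fun j _ => hx j) (Finset.mem_univ k)
  rw [norm_smul]
  gcongr
  exact abs_le.2 ⟨(neg_nonpos.2 zero_le_one).trans (hx k), hk⟩

theorem regular_coord [NeZero d] (b : SimplexBasis F d) (k : Fin (d + 1)) :
    Regular (b.coord k) := by
  obtain ⟨j, hj⟩ := exists_ne k
  refine regular_of_apply_ne (x := b k) (y := b j) ?_
  rw [b.coord_apply_eq, b.coord_apply_ne hj.symm]
  exact one_ne_zero

theorem isConvexPolytope_simplex [NeZero d] (b : SimplexBasis F d) :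
    IsConvexPolytope (simplex b) := by
  classical
  refine ⟨isBounded_simplex b, Finset.univ.image b.coord, ?_, ?_⟩
  · simpa using regular_coord b
  · ext x
    simp [mem_simplex, closedHalfSpace]

theorem rank_simplex (b : SimplexBasis F d) : rank (simplex b) = d := by
  have htop : affineSpan F (simplex b) = ⊤ :=
    eq_top_iff.2 (b.tot ▸ affineSpan_mono F (range_subset_iff.2 (vertex_mem_simplex b)))
  rw [rank, htop, AffineSubspace.direction_top, finrank_top, Module.finrank_fin_fun]

theorem isPolytope_simplex [NeZero d] (b : SimplexBasis F d) : IsPolytope d (simplex b) :=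
  ⟨{simplex b}, finite_singleton _, by
    rintro _ rfl
    exact ⟨isConvexPolytope_simplex b, ⟨b 0, vertex_mem_simplex b 0⟩, rank_simplex b⟩,
    (sUnion_singleton _).symm⟩

/-- The image of an affine basis under an affine equivalence. -/
def mapBasis (φ : Space F d ≃ᵃ[F] Space F d) (b : SimplexBasis F d) : SimplexBasis F d where
  toFun := φ ∘ b
  ind' := φ.affineIndependent_iff.2 b.ind
  tot' := (range_comp φ b).symm ▸ φ.span_eq_top_iff.1 b.tot

theorem coord_mapBasis (φ : Space F d ≃ᵃ[F] Space F d) (b : SimplexBasis F d) (k : Fin (d + 1))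
    (x : Space F d) : (mapBasis φ b).coord k x = b.coord k (φ.symm x) := by
  have hvertex : ∀ l, φ.symm (mapBasis φ b l) = b l := fun l => φ.symm_apply_apply (b l)
  refine .trans ?_ (apply_eq_sum_coord ((b.coord k).comp φ.symm.toAffineMap) (mapBasis φ b) x).symm
  simp [hvertex, b.coord_apply]

theorem image_simplex (φ : Space F d ≃ᵃ[F] Space F d) (b : SimplexBasis F d) :
    φ '' simplex b = simplex (mapBasis φ b) := by
  ext x
  simp only [mem_image_affineEquiv, mem_simplex, coord_mapBasis]

theorem exists_le_apply_of_isBounded {S : Set (Space F d)} (hS : Bornology.IsBounded S)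
    (ξ : Space F d →ᵃ[F] F) : ∃ C : F, ∀ x ∈ S, C ≤ ξ x := by
  obtain ⟨a, c, rfl⟩ := exists_eq_affineFunctional ξ
  obtain ⟨R, hR⟩ := hS.exists_norm_le
  obtain ⟨n, hn⟩ := exists_nat_ge R
  refine ⟨-(∑ i, |a i| * n) + c, fun x hx => ?_⟩
  rw [affineFunctional_apply]
  gcongr
  rw [neg_le, dotProduct, ← Finset.sum_neg_distrib]
  refine Finset.sum_le_sum fun i _ => ?_
  have hx' : |x i| ≤ n := ((norm_le_pi_norm x i).trans (hR x hx)).trans hn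
  calc -(a i * x i) ≤ |a i * x i| := neg_le_abs _
    _ = |a i| * |x i| := abs_mul _ _
    _ ≤ |a i| * n := by gcongr

theorem exists_subset_simplex {S : Set (Space F d)} (hS : Bornology.IsBounded S) :
    ∃ b : SimplexBasis F d, S ⊆ simplex b := by
  obtain ⟨b⟩ : Nonempty (SimplexBasis F d) :=
    AffineBasis.exists_affineBasis_of_finiteDimensional (by simp)
  choose C hC using fun k => exists_le_apply_of_isBounded hS (b.coord k)
  obtain ⟨n, hn, hn₀⟩ := ((eventually_all.2 fun k => (tendsto_natCast_atTop_atTop (R := F)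
    |>.eventually_ge_atTop (1 - (d + 1) * C k))).and (eventually_gt_atTop 0)).exists
  have hn₀' : (n : F) ≠ 0 := Nat.cast_ne_zero.2 hn₀.ne'
  let c := Finset.univ.centroid F b
  let φ := AffineEquiv.homothetyUnitsMulHom c (Units.mk0 (n : F) hn₀')
  refine ⟨mapBasis φ b, fun x hx k => ?_⟩
  have hc : b.coord k c = (d + 1 : F)⁻¹ :=
    (b.coord_apply_centroid (Finset.mem_univ k)).trans (by simp)
  have hφ : φ.symm x = AffineMap.lineMap c x (n : F)⁻¹ :=
    congr($(AffineEquiv.coe_homothetyUnitsMulHom_apply_symm c _) x).trans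
      (AffineMap.homothety_eq_lineMap _ _ _)
  have hx : 1 - (d + 1) * b.coord k x ≤ n := le_trans (by gcongr; exact hC k x hx) (hn k)
  have hcoord : b.coord k (φ.symm x) =
      (n - (1 - (d + 1) * b.coord k x)) / ((d + 1) * n) := by
    rw [hφ, AffineMap.apply_lineMap, hc, AffineMap.lineMap_apply_ring]
    field_simp
    ring
  rw [coord_mapBasis, hcoord]
  exact div_nonneg (sub_nonneg.2 hx) (by positivity)

/-! ### Dissection of simplices -/

theorem affineIndependent_update_of_coord_ne_zero (b : SimplexBasis F d) {j : Fin (d + 1)}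
    {p : Space F d} (hp : b.coord j p ≠ 0) : AffineIndependent F (Function.update b j p) := by
  refine b.ind.affineIndependent_update_of_notMem_affineSpan fun h => hp ?_
  have hle : affineSpan F (b '' {k | k ≠ j}) ≤ (affineSpan F {0}).comap (b.coord j) :=
    affineSpan_le.2 (forall_mem_image.2 fun k hk => by
      simpa using b.coord_apply_ne (Ne.symm hk))
  simpa using hle h

/-- The affine basis obtained by moving the vertex `b j` to a point `p` that does not lie on the
hyperplane through the other vertices. -/
def replaceVertex (b : SimplexBasis F d) {j : Fin (d + 1)} {p : Space F d}
    (hp : b.coord j p ≠ 0) : SimplexBasis F d where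
  toFun := Function.update b j p
  ind' := affineIndependent_update_of_coord_ne_zero b hp
  tot' := (affineIndependent_update_of_coord_ne_zero b hp)
    |>.affineSpan_eq_top_iff_card_eq_finrank_add_one.2 (by simp)

theorem replaceVertex_apply (b : SimplexBasis F d) {j : Fin (d + 1)} {p : Space F d}
    (hp : b.coord j p ≠ 0) (k : Fin (d + 1)) :
    replaceVertex b hp k = Function.update b j p k := rfl

theorem coord_eq_coord_replaceVertex (b : SimplexBasis F d) {j : Fin (d + 1)} {p : Space F d}
    (hp : b.coord j p ≠ 0) (k : Fin (d + 1)) (x : Space F d) :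
    b.coord k x = (replaceVertex b hp).coord j x * b.coord k p +
      if k = j then 0 else (replaceVertex b hp).coord k x := by
  rw [apply_eq_sum_coord (b.coord k) (replaceVertex b hp), ← Finset.add_sum_erase _ _
    (Finset.mem_univ j), replaceVertex_apply, Function.update_self]
  congr 1
  rw [Finset.sum_congr rfl fun l hl => by
    rw [replaceVertex_apply, Function.update_of_ne (Finset.ne_of_mem_erase hl), b.coord_apply]]
  simp

theorem coord_replaceVertex_self (b : SimplexBasis F d) {j : Fin (d + 1)} {p : Space F d}
    (hp : b.coord j p ≠ 0) (x : Space F d) :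
    (replaceVertex b hp).coord j x = b.coord j x / b.coord j p := by
  rw [eq_div_iff hp, coord_eq_coord_replaceVertex b hp j x, if_pos rfl, add_zero]

theorem coord_replaceVertex_of_ne (b : SimplexBasis F d) {j k : Fin (d + 1)} (hk : k ≠ j)
    {p : Space F d} (hp : b.coord j p ≠ 0) (x : Space F d) :
    (replaceVertex b hp).coord k x = b.coord k x - b.coord j x / b.coord j p * b.coord k p := by
  rw [← coord_replaceVertex_self b hp, coord_eq_coord_replaceVertex b hp k x, if_neg hk,
    add_sub_cancel_left]

theorem mem_simplex_replaceVertex {b : SimplexBasis F d} {i j : Fin (d + 1)} (hij : i ≠ j)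
    {p : Space F d} (hp : p ∈ simplex b) (hj : b.coord j p ≠ 0)
    (h : ∀ k, k ≠ i → k ≠ j → b.coord k p = 0) {x : Space F d} :
    x ∈ simplex (replaceVertex b hj) ↔
      x ∈ simplex b ∧ b.coord j x * b.coord i p ≤ b.coord i x * b.coord j p := by
  have hpos : 0 < b.coord j p := (hp j).lt_of_ne' hj
  have hself : 0 ≤ (replaceVertex b hj).coord j x ↔ 0 ≤ b.coord j x := by
    rw [coord_replaceVertex_self, le_div_iff₀ hpos, zero_mul]
  have hi : 0 ≤ (replaceVertex b hj).coord i x ↔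
      b.coord j x * b.coord i p ≤ b.coord i x * b.coord j p := by
    rw [coord_replaceVertex_of_ne b hij, sub_nonneg, div_mul_eq_mul_div, div_le_iff₀ hpos]
  have hk : ∀ k, k ≠ i → k ≠ j → (replaceVertex b hj).coord k x = b.coord k x := fun k hki hkj => by
    rw [coord_replaceVertex_of_ne b hkj, h k hki hkj, mul_zero, sub_zero]
  constructor
  · refine fun hx => ⟨fun k => ?_, hi.1 (hx i)⟩
    rcases eq_or_ne k j with rfl | hkj
    · exact hself.1 (hx k)
    rcases eq_or_ne k i with rfl | hki
    · have hmul := (mul_nonneg (hself.1 (hx j)) (hp k)).trans (hi.1 (hx k))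
      exact nonneg_of_mul_nonneg_left hmul hpos
    · exact hk k hki hkj ▸ hx k
  · rintro ⟨hx, hle⟩ k
    rcases eq_or_ne k j with rfl | hkj
    · exact hself.2 (hx k)
    rcases eq_or_ne k i with rfl | hki
    · exact hi.2 hle
    · exact hk k hki hkj ▸ hx k

theorem genericPartition_simplex {b : SimplexBasis F d} {i j : Fin (d + 1)} (hij : i ≠ j)
    {p : Space F d} (hp : p ∈ simplex b) (hi : b.coord i p ≠ 0) (hj : b.coord j p ≠ 0)
    (h : ∀ k, k ≠ i → k ≠ j → b.coord k p = 0) :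
    GenericPartition (simplex b) fun c : Bool =>
      simplex (cond c (replaceVertex b hj) (replaceVertex b hi)) := by
  let η : Space F d →ᵃ[F] F := b.coord j p • b.coord i - b.coord i p • b.coord j
  have hη : Regular η := regular_of_apply_ne (x := b i) (y := p) (by
    simpa [η, b.coord_apply_ne hij.symm, mul_comm] using hj)
  filter_upwards [hη.eventually_ne] with x hx
  have hne : b.coord j x * b.coord i p ≠ b.coord i x * b.coord j p := fun h => hx <| by
    simp [η, mul_comm (b.coord j p), mul_comm (b.coord i p), h]
  have hmem := mem_simplex_replaceVertex (x := x) hij hp hj h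
  have hmem' := mem_simplex_replaceVertex (x := x) hij.symm hp hi
    fun k hkj hki => h k hki hkj
  rw [Bool.exists_bool]
  constructor
  · rintro (_ | _) (_ | _) hx hx'
    · rfl
    · exact absurd ((hmem'.1 hx).2.antisymm (hmem.1 hx').2) hne.symm
    · exact absurd ((hmem.1 hx).2.antisymm (hmem'.1 hx').2) hne
    · rfl
  · exact ⟨fun hx => (le_total _ _).imp (hmem'.2 ⟨hx, ·⟩) (hmem.2 ⟨hx, ·⟩),
      fun h => h.elim (hmem'.1 · |>.1) (hmem.1 · |>.1)⟩

/-- `S` is, up to a finite union of hyperplanes, partitioned into finitely many simplices whose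
vertices have the property `p`. -/
def Triangulable (p : SimplexBasis F d → Prop) (S : Set (Space F d)) : Prop :=
  ∃ (ι : Type) (_ : Finite ι) (b : ι → SimplexBasis F d),
    GenericPartition S (fun i => simplex (b i)) ∧ ∀ i, p (b i)

namespace Triangulable

variable {p q : SimplexBasis F d → Prop} {S T : Set (Space F d)}

theorem simplex {b : SimplexBasis F d} (hb : p b) : Triangulable p (simplex b) :=
  ⟨Unit, inferInstance, fun _ => b, genericPartition_const _, fun _ => hb⟩

theorem mono (h : Triangulable p S) (hpq : ∀ b, p b → q b) : Triangulable q S := by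
  obtain ⟨ι, _, b, hb, hp⟩ := h
  exact ⟨ι, inferInstance, b, hb, fun i => hpq _ (hp i)⟩

theorem bind (h : Triangulable p S) (hpq : ∀ b, p b → Triangulable q (RefinedGeometry.simplex b)) :
    Triangulable q S := by
  obtain ⟨ι, _, b, hb, hp⟩ := h
  choose κ _ c hc hq using fun i => hpq (b i) (hp i)
  exact ⟨Σ i, κ i, inferInstance, fun k => c k.1 k.2, hb.sigma hc, fun k => hq k.1 k.2⟩

theorem and_eventually_mem (h : Triangulable p S) :
    Triangulable (fun b => p b ∧ ∀ᶠ x in generic F d, x ∈ RefinedGeometry.simplex b → x ∈ S) S := by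
  obtain ⟨ι, _, b, hb, hp⟩ := h
  exact ⟨ι, inferInstance, b, hb, fun i => ⟨hp i, hb.mono fun x hx hxi => hx.2.2 ⟨i, hxi⟩⟩⟩

theorem exists_genericPartition_of_subset (hST : S ⊆ T) (h : Triangulable (fun b =>
      (∀ᶠ x in generic F d, x ∈ RefinedGeometry.simplex b → x ∈ S) ∨
        ∀ᶠ x in generic F d, x ∈ RefinedGeometry.simplex b → x ∉ S) T) :
    ∃ (ι : Type) (_ : Finite ι) (b : ι → SimplexBasis F d),
      GenericPartition S fun i => RefinedGeometry.simplex (b i) := by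
  obtain ⟨ι, _, b, hb, hp⟩ := h
  refine ⟨{i // ∀ᶠ x in generic F d, x ∈ RefinedGeometry.simplex (b i) → x ∈ S}, inferInstance,
    fun i => b i, ?_⟩
  have hout : ∀ i, ∀ᶠ x in generic F d, x ∈ RefinedGeometry.simplex (b i) → x ∈ S →
      ∀ᶠ x in generic F d, x ∈ RefinedGeometry.simplex (b i) → x ∈ S := fun i =>
    (hp i).elim (fun h => .of_forall fun _ _ _ => h) fun h => h.mono fun x hx hxi hxS =>
      (hx hxi hxS).elim
  have hin : ∀ᶠ x in generic F d, ∀ i : {i // ∀ᶠ x in generic F d,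
      x ∈ RefinedGeometry.simplex (b i) → x ∈ S}, x ∈ RefinedGeometry.simplex (b i) → x ∈ S :=
    eventually_all.2 Subtype.property
  filter_upwards [hb, hin, eventually_all.2 hout] with x hx hin hout
  refine ⟨fun i j hi hj => Subtype.ext (hx.1 i j hi hj), fun hxS => ?_, fun ⟨i, hi⟩ => hin i hi⟩
  obtain ⟨i, hi⟩ := hx.2.1 (hST hxS)
  exact ⟨⟨i, hout i hi hxS⟩, hi⟩

end Triangulable

/-- `ξ` has the same sign at all points of the simplex with vertices `b`, up to a finite union of
hyperplanes. -/
def HasConstantSign (ξ : Space F d →ᵃ[F] F) (b : SimplexBasis F d) : Prop :=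
  ∃ σ, ∀ᶠ x in generic F d, x ∈ simplex b → SignType.sign (ξ x) = σ

theorem HasConstantSign.anti {ξ : Space F d →ᵃ[F] F} {b b' : SimplexBasis F d}
    (h : HasConstantSign ξ b) (hb : ∀ᶠ x in generic F d, x ∈ simplex b' → x ∈ simplex b) :
    HasConstantSign ξ b' := by
  obtain ⟨σ, hσ⟩ := h
  exact ⟨σ, (hσ.and hb).mono fun x hx hx' => hx.1 (hx.2 hx')⟩

theorem hasConstantSign_of_forall_nonneg {ξ : Space F d →ᵃ[F] F} (hξ : Regular ξ)
    {b : SimplexBasis F d} (h : ∀ k, 0 ≤ ξ (b k)) : HasConstantSign ξ b := by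
  refine ⟨1, hξ.eventually_ne.mono fun x hx hxb => sign_pos (lt_of_le_of_ne ?_ hx.symm)⟩
  rw [apply_eq_sum_coord ξ b]
  exact Finset.sum_nonneg fun k _ => mul_nonneg (hxb k) (h k)

theorem hasConstantSign_of_forall_nonpos {ξ : Space F d →ᵃ[F] F} (hξ : Regular ξ)
    {b : SimplexBasis F d} (h : ∀ k, ξ (b k) ≤ 0) : HasConstantSign ξ b := by
  refine ⟨-1, hξ.eventually_ne.mono fun x hx hxb => sign_neg (lt_of_le_of_ne ?_ hx)⟩
  rw [apply_eq_sum_coord ξ b]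
  exact Finset.sum_nonpos fun k _ => mul_nonpos_of_nonneg_of_nonpos (hxb k) (h k)

theorem exists_mem_edge_apply_eq_zero {ξ : Space F d →ᵃ[F] F} {b : SimplexBasis F d}
    {i j : Fin (d + 1)} (hi : ξ (b i) < 0) (hj : 0 < ξ (b j)) :
    ∃ p ∈ simplex b, ξ p = 0 ∧ b.coord i p ≠ 0 ∧ b.coord j p ≠ 0 ∧
      ∀ k, k ≠ i → k ≠ j → b.coord k p = 0 := by
  have hij : i ≠ j := fun h => (hi.trans hj).ne (h ▸ rfl)
  have hden : 0 < ξ (b j) - ξ (b i) := sub_pos.2 (hi.trans hj)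
  let t := -ξ (b i) / (ξ (b j) - ξ (b i))
  have ht₀ : 0 < t := div_pos (neg_pos.2 hi) hden
  have ht₁ : 0 < 1 - t := sub_pos.2 ((div_lt_one hden).2 (by linarith))
  have hcoord : ∀ k, b.coord k (AffineMap.lineMap (b i) (b j) t) =
      (1 - t) * (if k = i then 1 else 0) + t * (if k = j then 1 else 0) := fun k => by
    rw [AffineMap.apply_lineMap, AffineMap.lineMap_apply_ring, b.coord_apply, b.coord_apply]
  refine ⟨AffineMap.lineMap (b i) (b j) t, fun k => ?_, ?_, ?_, ?_, fun k hki hkj => ?_⟩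
  · rw [hcoord]
    split_ifs <;> positivity
  · rw [AffineMap.apply_lineMap, AffineMap.lineMap_apply_ring]
    simp only [t]
    field_simp
    ring
  · simpa [hcoord, hij] using ht₁.ne'
  · simpa [hcoord, hij.symm] using ht₀.ne'
  · simp [hcoord, hki, hkj]

theorem card_vertices_ne_zero_replaceVertex_lt {ξ : Space F d →ᵃ[F] F} {b : SimplexBasis F d}
    {j : Fin (d + 1)} {p : Space F d} (hp : b.coord j p ≠ 0) (hξp : ξ p = 0) (hξj : ξ (b j) ≠ 0) :
    ({k | ξ (replaceVertex b hp k) ≠ 0} : Finset (Fin (d + 1))).card <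
      ({k | ξ (b k) ≠ 0} : Finset (Fin (d + 1))).card := by
  have hself : ξ (replaceVertex b hp j) = 0 := by
    rwa [replaceVertex_apply, Function.update_self]
  refine Finset.card_lt_card ((Finset.ssubset_iff_of_subset fun k hk => ?_).2 ⟨j, ?_, ?_⟩)
  · rw [Finset.mem_filter_univ] at hk ⊢
    rcases eq_or_ne k j with rfl | hkj
    · exact hξj
    · rwa [replaceVertex_apply, Function.update_of_ne hkj] at hk
  · exact Finset.mem_filter_univ j |>.2 hξj
  · rw [Finset.mem_filter_univ, not_not]
    exact hself

theorem triangulable_simplex_hasConstantSign {ξ : Space F d →ᵃ[F] F} (hξ : Regular ξ)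
    (b : SimplexBasis F d) : Triangulable (HasConstantSign ξ) (simplex b) := by
  -- Cutting an edge at a zero of `ξ` replaces a vertex at which `ξ` does not vanish by one where
  -- it does.
  induction hn : ({k | ξ (b k) ≠ 0} : Finset (Fin (d + 1))).card using Nat.strong_induction_on
    generalizing b with
  | _ n ih =>
    subst hn
    by_cases hneg : ∃ i, ξ (b i) < 0
    swap
    · exact .simplex (hasConstantSign_of_forall_nonneg hξ fun k => not_lt.1 fun h => hneg ⟨k, h⟩)
    by_cases hpos : ∃ j, 0 < ξ (b j)
    swap
    · exact .simplex (hasConstantSign_of_forall_nonpos hξ fun k => not_lt.1 fun h => hpos ⟨k, h⟩)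
    obtain ⟨i, hi⟩ := hneg
    obtain ⟨j, hj⟩ := hpos
    obtain ⟨p, hp, hξp, hpi, hpj, hpk⟩ := exists_mem_edge_apply_eq_zero hi hj
    have hij : i ≠ j := fun h => (hi.trans hj).ne (h ▸ rfl)
    have hcut := genericPartition_simplex hij hp hpi hpj hpk
    exact Triangulable.bind ⟨Bool, inferInstance, _, hcut, Bool.forall_bool.2
      ⟨card_vertices_ne_zero_replaceVertex_lt hpi hξp hi.ne,
        card_vertices_ne_zero_replaceVertex_lt hpj hξp hj.ne'⟩⟩ fun b' hb' => ih _ hb' b' rfl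

theorem triangulable_simplex_forall_hasConstantSign {Ξ : Set (Space F d →ᵃ[F] F)} (hΞ : Ξ.Finite)
    (hreg : ∀ ξ ∈ Ξ, Regular ξ) (b : SimplexBasis F d) :
    Triangulable (fun b => ∀ ξ ∈ Ξ, HasConstantSign ξ b) (simplex b) := by
  induction Ξ, hΞ using Set.Finite.induction_on with
  | empty => exact .simplex (by simp)
  | @insert ξ Ξ _ _ ih =>
    refine (ih fun ξ hξ => hreg ξ (mem_insert_of_mem _ hξ)).bind fun b hb => ?_
    have hξ := triangulable_simplex_hasConstantSign (hreg ξ (mem_insert _ _)) b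
    exact hξ.and_eventually_mem.mono fun b' hb' =>
      forall_mem_insert.2 ⟨hb'.1, fun η hη => (hb η hη).anti hb'.2⟩

theorem Polyhedral.exists_genericPartition_simplex {S : Set (Space F d)} (hS : Polyhedral S)
    (hb : Bornology.IsBounded S) :
    ∃ (ι : Type) (_ : Finite ι) (b : ι → SimplexBasis F d),
      GenericPartition S fun i => simplex (b i) := by
  obtain ⟨b₀, hb₀⟩ := exists_subset_simplex hb
  obtain ⟨Ξ, hΞ, hreg, h⟩ := hS
  have hsign := triangulable_simplex_forall_hasConstantSign hΞ hreg b₀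
  refine Triangulable.exists_genericPartition_of_subset hb₀ (hsign.mono fun b hb => ?_)
  choose! σ hσ using hb
  have hall : ∀ᶠ x in generic F d, ∀ ξ ∈ Ξ, x ∈ simplex b → SignType.sign (ξ x) = σ ξ :=
    (eventually_all_finite hΞ).2 hσ
  by_cases hex : ∃ y ∈ S, ∀ ξ ∈ Ξ, SignType.sign (ξ y) = σ ξ
  · obtain ⟨y, hyS, hy⟩ := hex
    exact .inl <| hall.mono fun x hx hxb =>
      (h x y fun ξ hξ => (hx ξ hξ hxb).trans (hy ξ hξ).symm).2 hyS
  · exact .inr <| hall.mono fun x hx hxb hxS => hex ⟨x, hxS, fun ξ hξ => hx ξ hξ hxb⟩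

/-! ### Triangles and rectangles -/

/-- The affine equivalence sending a point to its barycentric coordinates with respect to `b`,
the zeroth one being omitted. -/
def coordEquiv (b : SimplexBasis F d) : Space F d ≃ᵃ[F] Space F d :=
  .ofBijective (φ := AffineMap.pi fun k => b.coord k.succ) <| by
    have hinj : Function.Injective (AffineMap.pi fun k : Fin d => b.coord k.succ) := fun x y h => by
      have hsucc : ∀ k : Fin d, b.coord k.succ x = b.coord k.succ y := fun k => congrFun h k
      refine b.ext_elem (Fin.forall_fin_succ.2 ⟨?_, hsucc⟩)
      have hsum := (b.sum_coord_apply_eq_one x).trans (b.sum_coord_apply_eq_one y).symm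
      rw [Fin.sum_univ_succ, Fin.sum_univ_succ, Finset.sum_congr rfl fun k _ => hsucc k] at hsum
      exact add_right_cancel hsum
    rw [← AffineMap.linear_injective_iff] at hinj
    rw [← AffineMap.linear_bijective_iff]
    exact ⟨hinj, LinearMap.injective_iff_surjective.1 hinj⟩

/-- The simplex whose vertices are the origin and the standard basis vectors. -/
def corner (F : Subfield ℝ) (d : ℕ) : Set (Space F d) :=
  {x | (∀ k, 0 ≤ x k) ∧ ∑ k, x k ≤ 1}

theorem mem_corner {x : Space F d} : x ∈ corner F d ↔ (∀ k, 0 ≤ x k) ∧ ∑ k, x k ≤ 1 := Iff.rfl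

theorem image_corner (b : SimplexBasis F d) :
    (coordEquiv b).symm '' corner F d = simplex b := by
  ext x
  have hcoord : ∀ k, coordEquiv b x k = b.coord k.succ x := fun k => rfl
  have hsum := b.sum_coord_apply_eq_one x
  rw [Fin.sum_univ_succ] at hsum
  have hx : (coordEquiv b).symm.symm x = coordEquiv b x := rfl
  rw [mem_image_affineEquiv, hx, mem_corner, mem_simplex, Fin.forall_fin_succ, and_comm]
  simp only [hcoord]
  refine and_congr_left fun _ => ?_
  rw [← hsum, le_add_iff_nonneg_left]

theorem polyhedral_corner [NeZero d] : Polyhedral (corner F d) := by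
  have h : corner F d =
      (⋂ k, {x | 0 ≤ x k}) ∩ closedHalfSpace (affineFunctional (-1 : Space F d) 1) := by
    ext x
    simp [mem_corner, closedHalfSpace, one_dotProduct]
  exact h ▸ (Polyhedral.iInter fun k => polyhedral_setOf_le_apply k 0).inter
    (polyhedral_closedHalfSpace (regular_affineFunctional (by simp) 1))

theorem isBounded_corner : Bornology.IsBounded (corner F d) :=
  (isBounded_box 0 2).subset fun _ hx => mem_box.2 fun k => ⟨hx.1 k,
    ((Finset.single_le_sum (fun i _ => hx.1 i) (Finset.mem_univ k)).trans hx.2).trans_lt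
      one_lt_two⟩

theorem mem_image_constVSub {c : Space F d} {S : Set (Space F d)} {x : Space F d} :
    x ∈ AffineEquiv.constVSub F c '' S ↔ c - x ∈ S := by
  refine ⟨?_, fun h => ⟨c - x, h, sub_sub_cancel c x⟩⟩
  rintro ⟨y, hy, rfl⟩
  exact (sub_sub_cancel c y).symm ▸ hy

theorem constVSub_mem_signedTranslations (c : Space F d) :
    AffineEquiv.constVSub F c ∈ signedTranslations F d :=
  ⟨-1, fun v => by simp [Units.neg_smul]⟩

theorem eventually_apply_ne (i : Fin d) (c : F) : ∀ᶠ x in generic F d, x i ≠ c :=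
  (regular_affineFunctional (a := Pi.single i 1) (by simp) (-c)).eventually_ne.mono fun x hx h =>
    hx (by simp [h])

theorem eventually_sum_apply_ne [NeZero d] (c : F) : ∀ᶠ x in generic F d, ∑ k, x k ≠ c :=
  (regular_affineFunctional (a := 1) one_ne_zero (-c)).eventually_ne.mono fun x hx h =>
    hx (by simp [one_dotProduct, h])

theorem scissorsCongruent_corner_box : ScissorsCongruent (corner F 2) (box 0 ![1 / 2, 1]) := by
  -- Cut the triangle along `x₀ = 1 / 2` and turn the tip about the midpoint of the hypotenuse.
  let H : Set (Space F 2) := {x | 1 / 2 ≤ x 0}ᶜ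
  have hS : ∀ x : Space F 2, x ∈ corner F 2 ∩ H ↔
      ((0 ≤ x 0 ∧ 0 ≤ x 1) ∧ x 0 + x 1 ≤ 1) ∧ x 0 < 1 / 2 := fun x => by
    simp [mem_corner, H, Fin.forall_fin_two]
  have hg : ∀ x, x ∈ AffineEquiv.constVSub F (1 : Space F 2) '' (corner F 2 \ H) ↔
      (x 1 ≤ 1 ∧ 1 ≤ x 0 + x 1) ∧ x 0 ≤ 1 / 2 := fun x => by
    rw [mem_image_constVSub, Set.mem_sdiff, mem_corner, notMem_compl_iff, mem_ofPred_eq,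
      Fin.forall_fin_two, Fin.sum_univ_two]
    simp only [Pi.sub_apply, Pi.one_apply]
    constructor <;> grind
  have hbox : ∀ x : Space F 2, x ∈ box 0 ![1 / 2, 1] ↔
      (0 ≤ x 0 ∧ x 0 < 1 / 2) ∧ 0 ≤ x 1 ∧ x 1 < 1 := fun x => by
    simp [mem_box, Fin.forall_fin_two]
  have hgen : ∀ᶠ x in generic F 2, x 0 ≠ 1 / 2 ∧ x 1 ≠ 1 ∧ x 0 + x 1 ≠ 1 := by
    filter_upwards [eventually_apply_ne 0 (1 / 2), eventually_apply_ne 1 1,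
      eventually_sum_apply_ne 1] with x h₀ h₁ h₀₁
    exact ⟨h₀, h₁, Fin.sum_univ_two x ▸ h₀₁⟩
  refine ScissorsCongruent.congr (.of_cut polyhedral_corner isBounded_corner
    (polyhedral_setOf_le_apply 0 (1 / 2)).compl (constVSub_mem_signedTranslations 1) ?_) .rfl ?_
  · filter_upwards [hgen] with x hx hxS hxg
    exact hx.2.2 (((hS x).1 hxS).1.2.antisymm ((hg x).1 hxg).1.2)
  · filter_upwards [hgen] with x hx
    refine propext (or_congr (hS x) (hg x) |>.trans (.trans ?_ (hbox x).symm))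
    grind

theorem exists_scissorsCongruent_rectangle_of_simplex (b : SimplexBasis F 2) :
    ∃ r : F, 0 < r ∧ ScissorsCongruent (simplex b) (rectangle r) := by
  have hw : ∀ i, (0 : F) < ![1 / 2, 1] i := Fin.forall_fin_two.2 ⟨one_half_pos, one_pos⟩
  let φ := affineEquivOfDet (Matrix.diagonal ![(1 / 2 : F), 1]) (by simp)
  have h := scissorsCongruent_corner_box.image (coordEquiv b).symm
  rw [image_corner, ← image_diagonal_mulVec_unitCube hw] at h
  obtain ⟨r, hr, h'⟩ := exists_scissorsCongruent_rectangle_of_image (φ.trans (coordEquiv b).symm)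
  exact ⟨r, hr, h.trans ((image_image (coordEquiv b).symm φ _).symm ▸ h')⟩

theorem mem_rectangle {r : F} {x : Space F 2} :
    x ∈ rectangle r ↔ (0 ≤ x 0 ∧ x 0 < 1) ∧ 0 ≤ x 1 ∧ x 1 < r := by
  simp [rectangle, mem_box, Fin.forall_fin_two]

theorem mem_image_constVAdd_rectangle {r s : F} {x : Space F 2} :
    x ∈ AffineEquiv.constVAdd F (Space F 2) ![0, r] '' rectangle s ↔
      (0 ≤ x 0 ∧ x 0 < 1) ∧ r ≤ x 1 ∧ x 1 < r + s := by
  have h : (AffineEquiv.constVAdd F (Space F 2) ![0, r]).symm x = ![x 0, x 1 - r] :=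
    funext <| Fin.forall_fin_two.2 ⟨by simp, neg_add_eq_sub _ _⟩
  rw [mem_image_affineEquiv, h, mem_rectangle]
  simp [sub_lt_iff_lt_add']

theorem genericPartition_rectangle_add {r s : F} (hr : 0 ≤ r) (hs : 0 ≤ s) :
    GenericPartition (rectangle (r + s)) fun c : Bool =>
      cond c (rectangle r) (AffineEquiv.constVAdd F (Space F 2) ![0, r] '' rectangle s) := by
  have h : rectangle (r + s) =
      rectangle r ∪ AffineEquiv.constVAdd F (Space F 2) ![0, r] '' rectangle s := by
    ext x
    rw [mem_union, mem_image_constVAdd_rectangle, mem_rectangle, mem_rectangle, ← and_or_left]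
    refine and_congr_right fun _ => ?_
    grind
  exact h ▸ genericPartition_union (.of_forall fun x hx hx' =>
    ((mem_rectangle.1 hx).2.2.trans_le (mem_image_constVAdd_rectangle.1 hx').2.1).false)

theorem ScissorsCongruent.union_rectangle {S T : Set (Space F 2)} {r s : F} (hr : 0 ≤ r)
    (hs : 0 ≤ s) (hS : ScissorsCongruent S (rectangle r)) (hT : ScissorsCongruent T (rectangle s))
    (h : ∀ᶠ x in generic F 2, x ∈ S → x ∉ T) :
    ScissorsCongruent (S ∪ T) (rectangle (r + s)) :=
  .of_genericPartition (genericPartition_union h) (genericPartition_rectangle_add hr hs)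
    (Bool.forall_bool.2 ⟨hT.trans (.of_image (constVAdd_mem_signedTranslations _)
      (polyhedral_box _ _) (isBounded_box _ _)), hS⟩)

theorem rectangle_zero : rectangle (0 : F) = ∅ :=
  eq_empty_of_forall_notMem fun _ hx =>
    ((mem_rectangle.1 hx).2.1.trans_lt (mem_rectangle.1 hx).2.2).false

theorem GenericPartition.exists_scissorsCongruent_rectangle {ι : Type*} [Finite ι]
    {S : Set (Space F 2)} {b : ι → SimplexBasis F 2}
    (h : GenericPartition S fun i => simplex (b i)) :
    ∃ r : F, 0 ≤ r ∧ ScissorsCongruent S (rectangle r) := by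
  classical
  have := Fintype.ofFinite ι
  have hunion : ∀ s : Finset ι, ∃ r : F, 0 ≤ r ∧
      ScissorsCongruent (⋃ i ∈ s, simplex (b i)) (rectangle r) := fun s => by
    induction s using Finset.induction_on with
    | empty =>
      have h := ScissorsCongruent.refl (polyhedral_box _ _) (isBounded_box 0 ![1, (0 : F)])
      rw [← rectangle, rectangle_zero] at h
      exact ⟨0, le_rfl, by simpa [rectangle_zero] using h⟩
    | insert i s hi ih =>
      obtain ⟨r, hr, hrs⟩ := ih
      obtain ⟨r', hr', hri⟩ := exists_scissorsCongruent_rectangle_of_simplex (b i)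
      refine ⟨r' + r, add_nonneg hr'.le hr, ?_⟩
      rw [Finset.set_biUnion_insert]
      refine hri.union_rectangle hr'.le hr hrs (h.mono fun x hx hxi hxs => ?_)
      obtain ⟨j, hj, hxj⟩ := mem_iUnion₂.1 hxs
      exact hi (hx.1 i j hxi hxj ▸ hj)
  obtain ⟨r, hr, hS⟩ := hunion Finset.univ
  refine ⟨r, hr, hS.congr (h.mono fun x hx => propext ?_) .rfl⟩
  change x ∈ ⋃ i ∈ Finset.univ, simplex (b i) ↔ x ∈ S
  simpa using hx.2.symm

theorem content_rectangle (r : F) : content (rectangle r) = ENNReal.ofReal r := by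
  simp [rectangle, content_box]

theorem scissorsCongruent_of_content_eq {S T : Set (Space F 2)} (hS : Polyhedral S)
    (hSb : Bornology.IsBounded S) (hT : Polyhedral T) (hTb : Bornology.IsBounded T)
    (h : content S = content T) : ScissorsCongruent S T := by
  obtain ⟨_, _, _, hS⟩ := hS.exists_genericPartition_simplex hSb
  obtain ⟨_, _, _, hT⟩ := hT.exists_genericPartition_simplex hTb
  obtain ⟨r, hr, hSr⟩ := hS.exists_scissorsCongruent_rectangle
  obtain ⟨s, hs, hTs⟩ := hT.exists_scissorsCongruent_rectangle
  rw [hSr.content_eq, hTs.content_eq, content_rectangle, content_rectangle,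
    ENNReal.ofReal_eq_ofReal_iff hr hs] at h
  obtain rfl := Subtype.ext h
  exact hSr.trans hTs.symm

theorem germSet_eq_germSet_iff {S T : Set (Space F d)} (hS : Polyhedral S) (hT : Polyhedral T) :
    germSet S = germSet T ↔ S =ᶠ[generic F d] T := by
  refine ⟨fun h => ?_, germSet_congr⟩
  obtain ⟨ρ⟩ : Nonempty (Resolution F d) := inferInstance
  filter_upwards [hS.eventually_mem_germ_iff, hT.eventually_mem_germ_iff] with x hxS hxT
  exact propext ((hxS ρ).symm.trans ((Set.ext_iff.1 h (x, ρ)).trans (hxT ρ)))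

theorem disjoint_germSet_iff {S T : Set (Space F d)} (hS : Polyhedral S) (hT : Polyhedral T) :
    Disjoint (germSet S) (germSet T) ↔ ∀ᶠ x in generic F d, x ∈ S → x ∉ T := by
  have hinter : germSet S ∩ germSet T = germSet (S ∩ T) := Set.ext fun _ => inter_mem_iff.symm
  have hempty : germSet (∅ : Set (Space F d)) = ∅ :=
    eq_empty_of_forall_notMem fun z => empty_notMem (germ z)
  rw [disjoint_iff_inter_eq_empty, hinter, ← hempty,
    germSet_eq_germSet_iff (hS.inter hT) .empty, eventuallyEq_empty]
  simp only [mem_inter_iff, not_and]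

theorem genericPartition_iff_germSet {ι : Type*} [Finite ι] {S : Set (Space F d)}
    {A : ι → Set (Space F d)} (hS : Polyhedral S) (hA : ∀ i, Polyhedral (A i)) :
    GenericPartition S A ↔ (∀ i j, i ≠ j → Disjoint (germSet (A i)) (germSet (A j))) ∧
      germSet S = ⋃ i, germSet (A i) := by
  rw [GenericPartition, eventually_and, ← germSet_iUnion hA,
    germSet_eq_germSet_iff hS (.iUnion hA), eventuallyEq_set]
  refine and_congr ?_ (by simp only [mem_iUnion])
  simp only [disjoint_germSet_iff (hA _) (hA _), eventually_all]
  exact forall₂_congr fun i j => by by_cases h : i = j <;> simp [h]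

theorem isRefinedPartition_refinement_iff (hF : ∀ x ∈ F, √(1 + x ^ 2) ∈ F)
    {P : Set (Space F 2)} (hP : IsPolygon P) {m : ℕ} {A : Fin m → Set (Space F 2)} :
    IsRefinedPartition A (refinement P) ↔
      (∀ i, IsPolygon (A i) ∧ (A i).Nonempty) ∧ GenericPartition P A := by
  refine and_congr_right fun hA => ?_
  rw [genericPartition_iff_germSet hP.polyhedral fun i => (hA i).1.polyhedral,
    refinement_eq_germSet hF hP]
  simp only [refinement_eq_germSet hF (hA _).1]

theorem ScissorsCongruent.exists_genericPartition_simplex {S T : Set (Space F d)}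
    (h : ScissorsCongruent S T) :
    ∃ (m : ℕ) (b c : Fin m → SimplexBasis F d), GenericPartition S (fun i => simplex (b i)) ∧
      GenericPartition T (fun i => simplex (c i)) ∧
      ∀ i, Congruent (simplex (b i)) (simplex (c i)) := by
  obtain ⟨ι, _, A, g, hA, hS, hT⟩ := h
  choose κ _ b hb using fun i => (hA i).1.exists_genericPartition_simplex (hA i).2
  let e := (Finite.equivFin (Σ i, κ i)).symm
  have hgb := fun i => (hb i).image (g i).1
  simp only [image_simplex] at hgb
  refine ⟨_, fun k => b (e k).1 (e k).2, fun k => mapBasis (g (e k).1).1 (b (e k).1 (e k).2),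
    (hS.sigma hb).reindex e, (hT.sigma hgb).reindex e, fun k => ?_⟩
  rw [← image_simplex]
  exact congruent_image_of_mem_signedTranslations (g _).2 _

end RefinedGeometry

end

theorem mainTheorem4 (F : Subfield ℝ) (hF : ∀ x ∈ F, √(1 + x ^ 2) ∈ F)
    (P Q : Set (RefinedGeometry.Space F 2))
    (hP : RefinedGeometry.IsPolygon P) (hQ : RefinedGeometry.IsPolygon Q) :
    RefinedGeometry.area P = RefinedGeometry.area Q ↔
      RefinedGeometry.Equidecomposable
        (RefinedGeometry.refinement P) (RefinedGeometry.refinement Q) := by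
  open RefinedGeometry in
  have isPolygon_simplex (b : SimplexBasis F 2) : IsPolygon (simplex b) ∧ (simplex b).Nonempty :=
    ⟨isPolytope_simplex b, _, vertex_mem_simplex b 0⟩
  change content P = content Q ↔ _
  constructor
  · intro h
    obtain ⟨m, b, c, hb, hc, hbc⟩ := (scissorsCongruent_of_content_eq hP.polyhedral hP.isBounded
      hQ.polyhedral hQ.isBounded h).exists_genericPartition_simplex
    exact ⟨m, _, _,
      (isRefinedPartition_refinement_iff hF hP).2 ⟨fun i => isPolygon_simplex (b i), hb⟩,
      (isRefinedPartition_refinement_iff hF hQ).2 ⟨fun i => isPolygon_simplex (c i), hc⟩, hbc⟩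
  · rintro ⟨m, A, B, hPA, hQB, hAB⟩
    obtain ⟨hA, hPA⟩ := (isRefinedPartition_refinement_iff hF hP).1 hPA
    obtain ⟨hB, hQB⟩ := (isRefinedPartition_refinement_iff hF hQ).1 hQB
    rw [hPA.content_eq fun i => (hA i).1.polyhedral, hQB.content_eq fun i => (hB i).1.polyhedral]
    exact Finset.sum_congr rfl fun i _ => (hAB i).content_eq
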